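/- Let $F$ be a field of characteristic zero, $G$ a group, $H$ an abelian group (written multiplicatively), and $\beta:H\times H\to F^*$ a skew-symmetric bicharacter, i.e. $\beta(gh,k)=\beta(g,k)\beta(h,k)$, $\beta(g,hk)=\beta(g,h)\beta(g,k)$ and $\beta(g,h)=\beta(h,g)^{-1}$. Algebras are associative $F$-algebras, not necessarily unital. For a group $K$ let $F\langle X|K\rangle$ be the free associative (non-unital) algebra on variables $x_{k,i}$ ($k\in K$, $i\in\mathbb N$), graded by $\deg x_{k,i}=k$. A $T_K$-ideal of it is a two-sided ideal invariant under all graded endomorphisms. For a $K$-graded algebra $A=\bigoplus_{k} A_k$ let $T_K(A)$ be the set of its graded polynomial identities, i.e. of the $f\in F\langle X|K\rangle$ that vanish whenever each $x_{k,i}$ is replaced by an element of $A_k$. For $n\ge 1$ and ${\bf k}=(k_1,\dots,k_n)\in K^n$ let $P_{\bf k}$ be the span of the monomials $x_{k_{\sigma(1)},\sigma(1)}\cdots x_{k_{\sigma(n)},\sigma(n)}$, $\sigma\in S_n$. A system of multilinear generators of $T_K(A)$ is a subset of $\bigcup_{n\ge1,\,{\bf k}\in K^n}P_{\bf k}$ that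 generates $T_K(A)$ as a $T_K$-ideal. An $H$-graded algebra $C=\bigoplus_h C_h$ is a color commutative superalgebra (with respect to the fixed $\beta$) if $ab=\beta(h,k)\,ba$ for all $a\in C_h$, $b\in C_k$. It generates the variety of all such algebras if every $H$-graded color commutative superalgebra satisfies all graded identities of $C$. The free color commutative superalgebra is the quotient of $F\langle X|H\rangle$ by the $T_H$-ideal generated by all $x_{h,i}x_{k,j}-\beta(h,k)x_{k,j}x_{h,i}$. For a sequence ${\bf h}=(h_i)_{i}$ in $H$ let $\phi_{\bf h}$ be the linear map on multilinear polynomials of $F\langle X|G\rangle$ with $$\phi_{\bf h}\bigl(x_{g_{\sigma(1)},\sigma(1)}\cdots x_{g_{\sigma(n)},\sigma(n)}\bigr)=\lambda_{{\bf h}\sigma}\,x_{(g_{\sigma(1)},h_{\sigma(1)}),\sigma(1)}\cdots x_{(g_{\sigma(n)},h_{\sigma(n)}),\sigma(n)}\in F\langle X|G\times H\rangle ,$$ where $\lambda_{{\bf h}\sigma}\in F^*$ is the scalar with $x_{h_1,1}\cdots x_{h_n,n}=\lambda_{{\bf h}\sigma}\,x_{h_{\sigma(1)},\sigma(1)}\cdots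 x_{h_{\sigma(n)},\sigma(n)}$ in the free color commutative superalgebra. A tuple ${\bf h}\in H^n$ is regarded as a sequence by adding neutral elements. Theorem. Let $C$ be an $H$-graded color commutative superalgebra that generates the variety of all $H$-graded color commutative superalgebras, and let $R$ be any $G$-graded algebra. Grade $R\otimes_F C$ by $G\times H$ with components $(R\otimes C)_{(g,h)}=R_g\otimes C_h$. If $\mathcal E\subseteq\bigcup_{n\ge1,\,{\bf g}\in G^n}P_{\bf g}$ is a system of multilinear generators of $T_G(R)$, then $$S=\{\phi_{\bf h}(f)\mid f\in\mathcal E,\ {\bf h}\in H^n,\ n\in\mathbb N\}$$ is a system of multilinear generators of $T_{G\times H}(R\otimes C)$. -/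

import Mathlib

namespace ColorPI

open scoped TensorProduct

universe u v

noncomputable section

/-! ### Graded algebras

Algebras are associative, not necessarily unital: a type `A` with
`[NonUnitalRing A] [Module F A] [IsScalarTower F A A] [SMulCommClass F A A]`. -/

/-- A `G`-grading on the algebra `A`: a decomposition `A = ⨁ A_g` into subspaces
with `A_g A_h ⊆ A_{gh}`. -/
structure IsGrading {F G A : Type*} [Field F] [Group G] [NonUnitalRing A] [Module F A]
    (𝒜 : G → Submodule F A) : Prop where
  indep : iSupIndep 𝒜
  iSup_eq_top : iSup 𝒜 = ⊤
  mul_mem : ∀ {g h : G} {a b : A}, a ∈ 𝒜 g → b ∈ 𝒜 h → a * b ∈ 𝒜 (g * h)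

/-- The grading by `G × H` on `R ⊗ C`, with components `R_g ⊗ C_h`. -/
def tensorGrading {F G H R C : Type*} [Field F] [NonUnitalRing R] [Module F R]
    [NonUnitalRing C] [Module F C] (ℛ : G → Submodule F R) (𝒞 : H → Submodule F C) :
    G × H → Submodule F (R ⊗[F] C) :=
  fun p => Submodule.span F {t | ∃ r ∈ ℛ p.1, ∃ c ∈ 𝒞 p.2, t = r ⊗ₜ[F] c}

/-! ### The free graded algebra and graded identities -/

/-- The free associative algebra `F⟨X|G⟩` on the variables `x_{g,i}`, `g ∈ G`, `i ∈ ℕ`: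
its basis consists of the nonempty words in these variables. -/
abbrev FreeAlg (F G : Type*) [Field F] : Type _ := MonoidAlgebra F (FreeSemigroup (G × ℕ))

/-- The monomial given by a word. -/
def mono (F : Type*) {G : Type*} [Field F] (w : FreeSemigroup (G × ℕ)) :
    FreeAlg F G := MonoidAlgebra.single w 1

/-- The variable `x_{g,i}`, of degree `g`. -/
def var (F : Type*) {G : Type*} [Field F] (g : G) (i : ℕ) : FreeAlg F G :=
  mono F (FreeSemigroup.of (g, i))

/-- The degree of a word: the product of the degrees of its letters. -/
def wordDeg {G : Type*} [Group G] : FreeSemigroup (G × ℕ) →ₙ* G :=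
  FreeSemigroup.lift Prod.fst

/-- The homogeneous component of degree `g` of `F⟨X|G⟩`. -/
def freeComponent (F : Type*) {G : Type*} [Field F] [Group G] (g : G) :
    Submodule F (FreeAlg F G) :=
  Submodule.span F {m | ∃ w, wordDeg w = g ∧ m = mono F w}

/-- The homomorphism from `F⟨X|G⟩` to `A` that sends each `x_{g,i}` to `a (g, i)`. -/
def evalHom {F G A : Type*} [Field F] [NonUnitalRing A] [Module F A]
    [IsScalarTower F A A] [SMulCommClass F A A] (a : G × ℕ → A) : FreeAlg F G →ₙₐ[F] A :=
  MonoidAlgebra.liftMagma F (FreeSemigroup.lift a)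

/-- `T_G(A)`: the set of graded polynomial identities of `A = ⨁ A_g`, i.e. of the polynomials
that vanish whenever each variable `x_{g,i}` is replaced by an element of `A_g`. -/
def gradedIdentities {F G A : Type*} [Field F] [NonUnitalRing A] [Module F A]
    [IsScalarTower F A A] [SMulCommClass F A A] (𝒜 : G → Submodule F A) :
    Set (FreeAlg F G) :=
  {f | ∀ a : G × ℕ → A, (∀ p, a p ∈ 𝒜 p.1) → evalHom (F := F) a f = 0}

/-- A `T_G`-ideal of `F⟨X|G⟩`: a two-sided ideal (and subspace) that is invariant under all
graded endomorphisms. -/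
structure IsTIdeal {F G : Type*} [Field F] [Group G] (I : Submodule F (FreeAlg F G)) : Prop where
  mul_mem_left : ∀ (u : FreeAlg F G) {f}, f ∈ I → u * f ∈ I
  mul_mem_right : ∀ (u : FreeAlg F G) {f}, f ∈ I → f * u ∈ I
  map_mem : ∀ θ : FreeAlg F G →ₙₐ[F] FreeAlg F G,
    (∀ g, ∀ f ∈ freeComponent F g, θ f ∈ freeComponent F g) → ∀ {f}, f ∈ I → θ f ∈ I

/-- The `T_G`-ideal generated by `S`: the intersection of all `T_G`-ideals containing `S`. -/
def tIdeal {F G : Type*} [Field F] [Group G] (S : Set (FreeAlg F G)) :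
    Submodule F (FreeAlg F G) :=
  sInf {I | IsTIdeal I ∧ S ⊆ I}

/-- The word `x_{g_{σ 0}, σ 0} x_{g_{σ 1}, σ 1} ⋯ x_{g_{σ n}, σ n}`. -/
def permWord {G : Type*} {n : ℕ} (g : Fin (n + 1) → G) (σ : Equiv.Perm (Fin (n + 1))) :
    FreeSemigroup (G × ℕ) :=
  ⟨(g (σ 0), (σ 0 : ℕ)), List.ofFn fun i : Fin n => (g (σ i.succ), (σ i.succ : ℕ))⟩

/-- The space `P_g` of multilinear polynomials for the tuple `g = (g_0, …, g_n)`. -/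
def multilinear (F : Type*) {G : Type*} [Field F] {n : ℕ} (g : Fin (n + 1) → G) :
    Submodule F (FreeAlg F G) :=
  Submodule.span F {m | ∃ σ : Equiv.Perm (Fin (n + 1)), m = mono F (permWord g σ)}

/-- `E` is a system of multilinear generators of the set `T` of identities: every element of `E`
lies in one of the spaces `P_g`, and `T` is the `T_G`-ideal generated by `E`. -/
def IsMultilinearGeneratingSet {F G : Type*} [Field F] [Group G]
    (E T : Set (FreeAlg F G)) : Prop :=
  (∀ f ∈ E, ∃ (n : ℕ) (g : Fin (n + 1) → G), f ∈ multilinear F g) ∧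
    (tIdeal E : Set (FreeAlg F G)) = T

/-! ### Color commutative superalgebras -/

/-- A skew-symmetric bicharacter on the abelian group `H` (written multiplicatively). -/
structure SkewBicharacter (F H : Type*) [Field F] [CommGroup H] where
  toFun : H → H → Fˣ
  map_mul_left : ∀ g h k, toFun (g * h) k = toFun g k * toFun h k
  map_mul_right : ∀ g h k, toFun g (h * k) = toFun g h * toFun g k
  skew : ∀ g h, toFun g h = (toFun h g)⁻¹

/-- `C = ⨁ C_h` is `β`-commutative: `ab = β(h,k) ba` for all `a ∈ C_h`, `b ∈ C_k`. -/
def IsColorCommutative {F H C : Type*} [Field F] [CommGroup H] [NonUnitalRing C] [Module F C]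
    (β : SkewBicharacter F H) (𝒞 : H → Submodule F C) : Prop :=
  ∀ h k : H, ∀ a ∈ 𝒞 h, ∀ b ∈ 𝒞 k, a * b = (β.toFun h k : F) • (b * a)

/-- `C` generates the variety of all `H`-graded `β`-commutative algebras: `C` belongs to this
variety, and every member of it satisfies all graded identities of `C`. The universe of `A` is the
one of the free algebra `F⟨X|H⟩`, so that all relatively free algebras are covered. -/
structure GeneratesColorVariety {F : Type u} {H : Type v} {C : Type*} [Field F] [CommGroup H]
    [NonUnitalRing C] [Module F C] [IsScalarTower F C C] [SMulCommClass F C C]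
    (β : SkewBicharacter F H) (𝒞 : H → Submodule F C) : Prop where
  isGrading : IsGrading 𝒞
  isColorCommutative : IsColorCommutative β 𝒞
  identities_subset : ∀ (A : Type (max u v)) [NonUnitalRing A] [Module F A]
    [IsScalarTower F A A] [SMulCommClass F A A] (𝒜 : H → Submodule F A),
    IsGrading 𝒜 → IsColorCommutative β 𝒜 → gradedIdentities 𝒞 ⊆ gradedIdentities 𝒜

/-- The `T_H`-ideal generated by the `β`-commutators `[x_{h,i}, x_{k,j}]_β`. -/
def colorIdeal {F H : Type*} [Field F] [CommGroup H] (β : SkewBicharacter F H) :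
    Submodule F (FreeAlg F H) :=
  tIdeal {f | ∃ (h k : H) (i j : ℕ),
    f = var F h i * var F k j - (β.toFun h k : F) • (var F k j * var F h i)}

/-- The free `H`-graded color commutative superalgebra (as a vector space): the quotient of
`F⟨X|H⟩` by the `T_H`-ideal generated by the `β`-commutators. -/
abbrev FreeColor {F H : Type*} [Field F] [CommGroup H] (β : SkewBicharacter F H) : Type _ :=
  FreeAlg F H ⧸ colorIdeal β

/-- The image of a word in the free color commutative superalgebra. -/
def colorMono {F H : Type*} [Field F] [CommGroup H] (β : SkewBicharacter F H)
    (w : FreeSemigroup (H × ℕ)) : FreeColor β :=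
  (colorIdeal β).mkQ (mono F w)

/-- The word with the same letters as `w`, in the order of increasing indices. -/
def sortWord {H : Type*} (w : FreeSemigroup (H × ℕ)) : FreeSemigroup (H × ℕ) :=
  match (w.head :: w.tail).insertionSort (fun p q => p.2 ≤ q.2) with
  | [] => w
  | p :: l => ⟨p, l⟩

theorem sortWord_perm {H : Type*} (w : FreeSemigroup (H × ℕ)) :
    ((sortWord w).head :: (sortWord w).tail).Perm (w.head :: w.tail) := by
  have h := List.perm_insertionSort (fun p q : H × ℕ => p.2 ≤ q.2) (w.head :: w.tail)
  unfold sortWord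
  split
  · rfl
  · rename_i heq
    rwa [heq] at h

section Sign

variable {F H : Type*} [Field F] [CommGroup H] (β : SkewBicharacter F H)

theorem isTIdeal_tIdeal {G : Type*} [Group G] (S : Set (FreeAlg F G)) : IsTIdeal (tIdeal S) := by
  constructor
  · intro u f hf
    simp only [tIdeal, Submodule.mem_sInf] at hf ⊢
    exact fun I hI => hI.1.mul_mem_left u (hf I hI)
  · intro u f hf
    simp only [tIdeal, Submodule.mem_sInf] at hf ⊢
    exact fun I hI => hI.1.mul_mem_right u (hf I hI)
  · intro θ hθ f hf
    simp only [tIdeal, Submodule.mem_sInf] at hf ⊢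
    exact fun I hI => hI.1.map_mem θ hθ (hf I hI)

theorem subset_tIdeal {G : Type*} [Group G] (S : Set (FreeAlg F G)) :
    S ⊆ (tIdeal S : Set (FreeAlg F G)) := by
  intro f hf
  simp only [tIdeal, SetLike.mem_coe, Submodule.mem_sInf]
  exact fun I hI => hI.2 hf

theorem mono_mul {G : Type*} (w w' : FreeSemigroup (G × ℕ)) :
    mono F (w * w') = mono F w * mono F w' := by
  simp [mono, MonoidAlgebra.single_mul_single]

/-- In the free color commutative superalgebra, rearranging the letters of a word multiplies it
by a nonzero scalar. -/
theorem exists_colorMono_perm {w w' : FreeSemigroup (H × ℕ)}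
    (hw : (w.head :: w.tail).Perm (w'.head :: w'.tail)) :
    ∃ c : Fˣ, colorMono β w = (c : F) • colorMono β w' := by
  have key : ∀ l l' : List (H × ℕ), l.Perm l' →
      (l = [] ∧ l' = []) ∨ ∃ (p q : H × ℕ) (t t' : List (H × ℕ)) (c : Fˣ),
        l = p :: t ∧ l' = q :: t' ∧
          mono F ⟨p, t⟩ - (c : F) • mono F ⟨q, t'⟩ ∈ colorIdeal β := by
    intro l l' h
    induction h with
    | nil => exact Or.inl ⟨rfl, rfl⟩
    | @cons x l₁ l₂ _ ih =>
      right
      rcases ih with ⟨rfl, rfl⟩ | ⟨p, q, t, t', c, rfl, rfl, hm⟩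
      · exact ⟨x, x, [], [], 1, rfl, rfl, by simp⟩
      · refine ⟨x, x, p :: t, q :: t', c, rfl, rfl, ?_⟩
        have := (isTIdeal_tIdeal _).mul_mem_left (mono F (FreeSemigroup.of x)) hm
        rwa [mul_sub, mul_smul_comm, ← mono_mul, ← mono_mul] at this
    | swap x y l₁ =>
      right
      refine ⟨y, x, x :: l₁, y :: l₁, β.toFun y.1 x.1, rfl, rfl, ?_⟩
      have h0 : var F y.1 y.2 * var F x.1 x.2
          - (β.toFun y.1 x.1 : F) • (var F x.1 x.2 * var F y.1 y.2) ∈ colorIdeal β :=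
        subset_tIdeal _ ⟨y.1, x.1, y.2, x.2, rfl⟩
      simp only [var, ← mono_mul] at h0
      cases l₁ with
      | nil => exact h0
      | cons z l₂ =>
        have := (isTIdeal_tIdeal _).mul_mem_right (mono F ⟨z, l₂⟩) h0
        rwa [sub_mul, smul_mul_assoc, ← mono_mul, ← mono_mul] at this
    | trans _ _ ih₁ ih₂ =>
      rcases ih₁ with ⟨rfl, rfl⟩ | ⟨p, q, t, t', c, rfl, rfl, hm⟩
      · exact ih₂
      · rcases ih₂ with ⟨h, _⟩ | ⟨p₂, q₂, t₂, t₂', c₂, h, rfl, hm₂⟩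
        · simp at h
        · right
          obtain ⟨rfl, rfl⟩ := List.cons.inj h
          refine ⟨p, q₂, t, t₂', c * c₂, rfl, rfl, ?_⟩
          have := Submodule.add_mem _ hm (Submodule.smul_mem _ (c : F) hm₂)
          simpa [smul_sub, smul_smul] using this
  rcases key _ _ hw with ⟨h, _⟩ | ⟨p, q, t, t', c, h, h', hm⟩
  · simp at h
  · obtain ⟨h₁, h₂⟩ := List.cons.inj h
    obtain ⟨h₃, h₄⟩ := List.cons.inj h'
    subst h₁ h₂ h₃ h₄
    refine ⟨c, ?_⟩
    rw [colorMono, colorMono, ← map_smul, ← sub_eq_zero, ← map_sub, Submodule.mkQ_apply,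
      Submodule.Quotient.mk_eq_zero]
    exact hm

theorem exists_colorSign (w : FreeSemigroup (H × ℕ)) :
    ∃ c : Fˣ, colorMono β (sortWord w) = (c : F) • colorMono β w :=
  exists_colorMono_perm β (sortWord_perm w)

/-- The coefficient `λ ∈ Fˣ` in the relation
`x_{h_1,i_1} ⋯ x_{h_k,i_k} = λ x_{h_{σ 1},i_{σ 1}} ⋯ x_{h_{σ k},i_{σ k}}`, `i_1 < ⋯ < i_k`,
which holds in the free color commutative superalgebra; `w` is the word on the right-hand side.
It is used for words with pairwise distinct indices, and for these it is unique. -/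
def colorSign (w : FreeSemigroup (H × ℕ)) : Fˣ :=
  Classical.choose (exists_colorSign β w)

end Sign

/-! ### The maps `φ_h` -/

/-- The `H`-part of a word: each letter `x_{(g,h),i}` becomes `x_{h,i}`. -/
def wordSnd {G H : Type*} : FreeSemigroup ((G × H) × ℕ) →ₙ* FreeSemigroup (H × ℕ) :=
  FreeSemigroup.map fun p => (p.1.2, p.2)

/-- The linear map `ζ` with `ζ(m) = λ m` on monomials. Only its values on multilinear monomials
matter. -/
def zeta {F G H : Type*} [Field F] [CommGroup H] (β : SkewBicharacter F H) :
    FreeAlg F (G × H) →ₗ[F] FreeAlg F (G × H) :=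
  (MonoidAlgebra.basis (FreeSemigroup ((G × H) × ℕ)) F).constr F
    fun w => (colorSign β (wordSnd w) : F) • mono F w

/-- The homomorphism `φ_h` of algebras with `x_{g,i} ↦ x_{(g,h_i),i}`, for a sequence `h` in `H`. -/
def varphi (F : Type*) {G H : Type*} [Field F] (h : ℕ → H) :
    FreeAlg F G →ₙₐ[F] FreeAlg F (G × H) :=
  evalHom fun p => var F (p.1, h p.2) p.2

/-- The linear map `ϕ_h` given by `ϕ_h(m) = ζ(φ_h(m))` on multilinear monomials `m`. -/
def phi {F G H : Type*} [Field F] [CommGroup H] (β : SkewBicharacter F H) (h : ℕ → H) :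
    FreeAlg F G →ₗ[F] FreeAlg F (G × H) :=
  zeta β ∘ₗ ((varphi F h : FreeAlg F G →ₙₐ[F] FreeAlg F (G × H)) : FreeAlg F G →ₗ[F] FreeAlg F (G × H))

/-- The sequence that extends a tuple by the neutral element. -/
def extendTuple {H : Type*} [One H] {n : ℕ} (h : Fin n → H) : ℕ → H :=
  fun i => if hi : i < n then h ⟨i, hi⟩ else 1

end

end ColorPI

/-! The sign in `phi` undoes reordering. For multilinear `f`, elements `r i` of `R` and homogeneous
`y i` of degree `h i` in `C`, evaluating `phi β h f` at the tensors `r i ⊗ y i` gives `f(r) ⊗ (y 0 ⋯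
y n)`. Hence `phi` sends multilinear identities of `R` to identities of `R ⊗ C`
(`phi_mem_gradedIdentities`).

Conversely, in characteristic zero the multilinear identities suffice
(`gradedIdentities_subset_of_multilinear`). A multilinear polynomial of degrees `(g i, h i)` is `phi
β h q`, where `q` arises by dividing its coefficients by the signs. Since `C` generates the variety,
some product `y 0 ⋯ y n` in degrees `h i` is nonzero, so if `phi β h q` is an identity of `R ⊗ C`,
then `q` is one of `R` and lies in the `T`-ideal of `E`.

It remains to see that `phi` carries multilinear consequences of `E` into the `T`-ideal `J`
generated by the `phi β h e` (`phi_mem_of_mem_tIdeal`). Consequences of `E` are not followed step by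
step. Instead, let `D` be color commutative for the inverse bicharacter. Evaluating an ordinary
multilinear `e` at `r i ⊗ z i` in `F⟨X|G × H⟩ ⊗ D`, with matching `H`-degrees, gives `(phi β l e)(r)
⊗ (z 0 ⋯ z m)`. So `E` consists of identities modulo `J ⊗ D`, and therefore so does its `T`-ideal.
Evaluating `q` at the variables tensored with elements of nonzero product in `D`, and applying a
functional on `D`, gives `phi β h q ∈ J`.

The nonzero products come from an explicit algebra with square-free monomials as basis
(`exists_color_model`). -/

namespace ColorPI

open scoped TensorProduct

universe u v

noncomputable section

set_option linter.unusedSectionVars false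

/-! ### Products of nonempty tuples in non-unital algebras, and evaluation of words. -/

section Products

variable {F : Type*} [Field F] {A B : Type*} [NonUnitalRing A] [Module F A] [IsScalarTower F A A]
  [SMulCommClass F A A] [NonUnitalRing B] [Module F B] [IsScalarTower F B B] [SMulCommClass F B B]

/-- The word whose letters are the entries of a nonempty tuple. -/
def tupleWord {L : Type*} {n : ℕ} (s : Fin (n + 1) → L) : FreeSemigroup L :=
  ⟨s 0, List.ofFn fun i : Fin n => s i.succ⟩

theorem permWord_eq_tupleWord {G : Type*} {n : ℕ} (g : Fin (n + 1) → G)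
    (σ : Equiv.Perm (Fin (n + 1))) :
    permWord g σ = tupleWord fun i => (g (σ i), (σ i : ℕ)) := rfl

theorem head_cons_tail_tupleWord {L : Type*} {n : ℕ} (s : Fin (n + 1) → L) :
    (tupleWord s).head :: (tupleWord s).tail = List.ofFn s := by
  simp [tupleWord, List.ofFn_succ]

theorem map_tupleWord {L L' : Type*} {n : ℕ} (f : L → L') (s : Fin (n + 1) → L) :
    FreeSemigroup.map f (tupleWord s) = tupleWord (f ∘ s) := by
  have key : ∀ (l : List L) (x : L),
      FreeSemigroup.map f ⟨x, l⟩ = ⟨f x, l.map f⟩ := by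
    intro l
    induction l with
    | nil => intro x; rfl
    | cons y l ih =>
      intro x
      have : (⟨x, y :: l⟩ : FreeSemigroup L) = FreeSemigroup.of x * ⟨y, l⟩ := rfl
      rw [this, map_mul, ih]
      rfl
  rw [tupleWord, key, tupleWord, List.map_ofFn]
  rfl

theorem exists_tupleWord {L : Type*} (w : FreeSemigroup L) :
    ∃ (n : ℕ) (s : Fin (n + 1) → L), w = tupleWord s := by
  refine ⟨w.tail.length, (w.head :: w.tail).get, ?_⟩
  ext1
  · rfl
  · simp [tupleWord]

/-- Allows sums over words to be reindexed as sums over tuples of all lengths. -/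
theorem tupleWord_injective {L : Type*} :
    Function.Injective fun p : Σ n, Fin (n + 1) → L => tupleWord p.2 := by
  rintro ⟨n, s⟩ ⟨m, t⟩ h
  have h' : List.ofFn s = List.ofFn t := by
    rw [← head_cons_tail_tupleWord, ← head_cons_tail_tupleWord]
    simp only at h
    rw [h]
  have hl : n = m := by simpa using congrArg List.length h'
  subst hl
  rw [List.ofFn_injective h']

/-- In the unitization a word becomes an ordinary list product; as `inr` is injective, product
formulas can be checked there. -/
theorem inr_lift {L : Type*} (a : L → A) (w : FreeSemigroup L) :
    (Unitization.inr (FreeSemigroup.lift a w) : Unitization F A) =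
      ((w.head :: w.tail).map fun x => (Unitization.inr (a x) : Unitization F A)).prod := by
  induction w with
  | ih1 x => simp
  | ih2 x y _ hy =>
    rw [map_mul, FreeSemigroup.lift_of, Unitization.inr_mul, hy]
    simp

/-- The product of a nonempty tuple of elements of a non-unital algebra, as a multilinear map. -/
def nprod (F : Type*) [Field F] {A : Type*} [NonUnitalRing A] [Module F A] [IsScalarTower F A A]
    [SMulCommClass F A A] (n : ℕ) : MultilinearMap F (fun _ : Fin (n + 1) => A) A :=
  (Unitization.sndHom F F A).compMultilinearMap
    ((MultilinearMap.mkPiAlgebraFin F (n + 1) (Unitization F A)).compLinearMap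
      fun _ => Unitization.inrHom F F A)

theorem nprod_apply {n : ℕ} (x : Fin (n + 1) → A) :
    nprod F n x = FreeSemigroup.lift x (tupleWord (id : Fin (n + 1) → Fin (n + 1))) := by
  have h := inr_lift (F := F) x (tupleWord (id : Fin (n + 1) → Fin (n + 1)))
  rw [head_cons_tail_tupleWord, List.map_ofFn] at h
  have h2 := congrArg (fun z => z.snd) h
  simp only [Unitization.snd_inr] at h2
  rw [h2]
  rfl

theorem inr_nprod {n : ℕ} (x : Fin (n + 1) → A) :
    (Unitization.inr (nprod F n x) : Unitization F A) =
      (List.ofFn fun i => (Unitization.inr (x i) : Unitization F A)).prod := by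
  rw [nprod_apply, inr_lift, head_cons_tail_tupleWord, List.map_ofFn]
  rfl

theorem lift_tupleWord {L : Type*} {n : ℕ} (a : L → A) (s : Fin (n + 1) → L) :
    FreeSemigroup.lift a (tupleWord s) = nprod F n (a ∘ s) := by
  apply Unitization.inr_injective (R := F)
  rw [inr_nprod, inr_lift, head_cons_tail_tupleWord, List.map_ofFn]
  rfl

theorem map_nprod (f : A →ₙₐ[F] B) {n : ℕ} (x : Fin (n + 1) → A) :
    f (nprod F n x) = nprod F n (f ∘ x) := by
  have key : ∀ w : FreeSemigroup (Fin (n + 1)),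
      f (FreeSemigroup.lift x w) = FreeSemigroup.lift (f ∘ x) w := by
    intro w
    induction w with
    | ih1 i => rfl
    | ih2 i y _ hy => simp [hy]
  rw [nprod_apply, nprod_apply, key]

theorem nprod_tmul {n : ℕ} (x : Fin (n + 1) → A) (y : Fin (n + 1) → B) :
    nprod F n (fun i => x i ⊗ₜ[F] y i) = nprod F n x ⊗ₜ[F] nprod F n y := by
  have key : ∀ w : FreeSemigroup (Fin (n + 1)),
      FreeSemigroup.lift (fun i => x i ⊗ₜ[F] y i) w =
        FreeSemigroup.lift x w ⊗ₜ[F] FreeSemigroup.lift y w := by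
    intro w
    induction w with
    | ih1 i => rfl
    | ih2 i v _ hv => simp [hv]
  rw [nprod_apply, nprod_apply, nprod_apply, key]

theorem evalHom_mono {G : Type*} (a : G × ℕ → A) (w : FreeSemigroup (G × ℕ)) :
    evalHom (F := F) a (mono F w) = FreeSemigroup.lift a w := by
  simp [evalHom, mono]

theorem evalHom_mono_tupleWord {G : Type*} {n : ℕ} (a : G × ℕ → A) (s : Fin (n + 1) → G × ℕ) :
    evalHom (F := F) a (mono F (tupleWord s)) = nprod F n (a ∘ s) := by
  rw [evalHom_mono, lift_tupleWord (F := F)]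

theorem evalHom_var {G : Type*} (a : G × ℕ → A) (g : G) (i : ℕ) :
    evalHom (F := F) a (var F g i) = a (g, i) := by
  rw [var, evalHom_mono, FreeSemigroup.lift_of]

theorem span_mono_eq_top {G : Type*} :
    Submodule.span F (Set.range (mono F : FreeSemigroup (G × ℕ) → FreeAlg F G)) = ⊤ := by
  rw [eq_top_iff]
  rintro f -
  induction f using MonoidAlgebra.induction_linear with
  | zero => exact zero_mem _
  | add f g hf hg => exact add_mem hf hg
  | single w c =>
    have : MonoidAlgebra.single w c = c • mono F w := by simp [mono]
    rw [this]
    exact Submodule.smul_mem _ _ (Submodule.subset_span ⟨w, rfl⟩)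

theorem linearMap_ext_mono {G M : Type*} [AddCommGroup M] [Module F M]
    {φ ψ : FreeAlg F G →ₗ[F] M} (h : ∀ w, φ (mono F w) = ψ (mono F w)) : φ = ψ :=
  LinearMap.ext_on_range span_mono_eq_top h

theorem comp_evalHom {G : Type*} (f : A →ₙₐ[F] B) (a : G × ℕ → A) (q : FreeAlg F G) :
    f (evalHom a q) = evalHom (F := F) (f ∘ a) q := by
  have : (f : A →ₗ[F] B) ∘ₗ (evalHom a : FreeAlg F G →ₙₐ[F] A) =
      ((evalHom (f ∘ a) : FreeAlg F G →ₙₐ[F] B) : FreeAlg F G →ₗ[F] B) := by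
    apply linearMap_ext_mono
    intro w
    obtain ⟨n, s, rfl⟩ := exists_tupleWord w
    change f (evalHom (F := F) a (mono F (tupleWord s))) = evalHom (F := F) (f ∘ a) _
    rw [evalHom_mono_tupleWord, evalHom_mono_tupleWord, map_nprod]
    rfl
  exact LinearMap.congr_fun this q

theorem evalHom_var_eq {G : Type*} (q : FreeAlg F G) :
    evalHom (F := F) (fun p : G × ℕ => var F p.1 p.2) q = q := by
  have : ((evalHom fun p : G × ℕ => var F p.1 p.2 : FreeAlg F G →ₙₐ[F] FreeAlg F G) :
      FreeAlg F G →ₗ[F] FreeAlg F G) = LinearMap.id := by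
    apply linearMap_ext_mono
    intro w
    change evalHom (F := F) _ (mono F w) = mono F w
    rw [evalHom_mono]
    induction w with
    | ih1 x => rfl
    | ih2 x y _ hy => rw [map_mul, hy, mono_mul]; rfl
  exact LinearMap.congr_fun this q

theorem evalHom_comp {G : Type*} (θ : FreeAlg F G →ₙₐ[F] FreeAlg F G) (a : G × ℕ → A)
    (q : FreeAlg F G) :
    evalHom (F := F) a (θ q) = evalHom (F := F) (fun p => evalHom a (θ (var F p.1 p.2))) q := by
  conv_lhs => rw [← evalHom_var_eq q, comp_evalHom, comp_evalHom]
  rfl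

end Products

/-! ### `T`-ideals and identities modulo an ideal. -/

section Ideals

variable {F G : Type*} [Field F] [Group G] {A : Type*} [NonUnitalRing A] [Module F A]
  [IsScalarTower F A A] [SMulCommClass F A A]

theorem tIdeal_le {S : Set (FreeAlg F G)} {I : Submodule F (FreeAlg F G)} (hI : IsTIdeal I)
    (h : S ⊆ I) : tIdeal S ≤ I :=
  sInf_le ⟨hI, h⟩

theorem mono_mem_freeComponent (w : FreeSemigroup (G × ℕ)) :
    mono F w ∈ freeComponent F (wordDeg w) :=
  Submodule.subset_span ⟨w, rfl, rfl⟩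

theorem var_mem_freeComponent (g : G) (i : ℕ) : var F g i ∈ freeComponent F g :=
  Submodule.subset_span ⟨FreeSemigroup.of (g, i), rfl, rfl⟩

theorem freeComponent_mul_mem {g h : G} {a b : FreeAlg F G} (ha : a ∈ freeComponent F g)
    (hb : b ∈ freeComponent F h) : a * b ∈ freeComponent F (g * h) := by
  refine Submodule.span_induction ?_ (by simp) ?_ ?_ ha
  · rintro _ ⟨w, rfl, rfl⟩
    refine Submodule.span_induction ?_ (by simp) ?_ ?_ hb
    · rintro _ ⟨v, rfl, rfl⟩
      rw [← mono_mul, ← map_mul]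
      exact mono_mem_freeComponent _
    · intro x y _ _ hx hy
      rw [mul_add]; exact add_mem hx hy
    · intro c x _ hx
      rw [mul_smul_comm]; exact Submodule.smul_mem _ _ hx
  · intro x y _ _ hx hy
    rw [add_mul]; exact add_mem hx hy
  · intro c x _ hx
    rw [smul_mul_assoc]; exact Submodule.smul_mem _ _ hx

theorem lift_mem_of_mul_mem {𝒜 : G → Submodule F A}
    (h𝒜 : ∀ {g h : G} {a b : A}, a ∈ 𝒜 g → b ∈ 𝒜 h → a * b ∈ 𝒜 (g * h))
    {L : Type*} {d : L → G} {a : L → A} (ha : ∀ p, a p ∈ 𝒜 (d p)) (w : FreeSemigroup L) :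
    FreeSemigroup.lift a w ∈ 𝒜 (FreeSemigroup.lift d w) := by
  induction w with
  | ih1 x => exact ha x
  | ih2 x y _ hy => rw [map_mul, map_mul]; exact h𝒜 (ha x) hy

theorem evalHom_mem {𝒜 : G → Submodule F A}
    (h𝒜 : ∀ {g h : G} {a b : A}, a ∈ 𝒜 g → b ∈ 𝒜 h → a * b ∈ 𝒜 (g * h))
    {a : G × ℕ → A} (ha : ∀ p, a p ∈ 𝒜 p.1) {g : G} {f : FreeAlg F G}
    (hf : f ∈ freeComponent F g) : evalHom (F := F) a f ∈ 𝒜 g := by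
  refine Submodule.span_induction ?_ (by simp) ?_ ?_ hf
  · rintro _ ⟨w, rfl, rfl⟩
    rw [evalHom_mono]
    exact lift_mem_of_mul_mem h𝒜 ha w
  · intro x y _ _ hx hy
    rw [map_add]; exact add_mem hx hy
  · intro c x _ hx
    rw [map_smul]; exact Submodule.smul_mem _ _ hx

/-- The polynomials all of whose graded evaluations lie in `I`. -/
def gradedIdentitiesMod (𝒜 : G → Submodule F A) (I : Submodule F A) :
    Submodule F (FreeAlg F G) where
  carrier := {f | ∀ a : G × ℕ → A, (∀ p, a p ∈ 𝒜 p.1) → evalHom (F := F) a f ∈ I}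
  zero_mem' := by intro a _; simp
  add_mem' := by
    intro x y hx hy a ha
    rw [map_add]; exact add_mem (hx a ha) (hy a ha)
  smul_mem' := by
    intro c x hx a ha
    rw [map_smul]; exact Submodule.smul_mem _ _ (hx a ha)

/-- A graded endomorphism followed by a graded evaluation is again a graded evaluation. The case `I
= ⊥` gives ordinary identities; the case `I = tensorIdeal D J` carries the main argument. -/
theorem isTIdeal_gradedIdentitiesMod {𝒜 : G → Submodule F A}
    (h𝒜 : ∀ {g h : G} {a b : A}, a ∈ 𝒜 g → b ∈ 𝒜 h → a * b ∈ 𝒜 (g * h)) {I : Submodule F A}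
    (hl : ∀ x, ∀ y ∈ I, x * y ∈ I) (hr : ∀ x, ∀ y ∈ I, y * x ∈ I) :
    IsTIdeal (gradedIdentitiesMod 𝒜 I) where
  mul_mem_left u f hf a ha := by rw [map_mul]; exact hl _ _ (hf a ha)
  mul_mem_right u f hf a ha := by rw [map_mul]; exact hr _ _ (hf a ha)
  map_mem θ hθ f hf a ha := by
    rw [evalHom_comp]
    exact hf _ fun p => evalHom_mem h𝒜 ha (hθ _ _ (var_mem_freeComponent _ _))

theorem coe_gradedIdentitiesMod_bot (𝒜 : G → Submodule F A) :
    (gradedIdentitiesMod 𝒜 ⊥ : Set (FreeAlg F G)) = gradedIdentities 𝒜 := by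
  ext f
  simp [gradedIdentitiesMod, gradedIdentities]

theorem evalHom_mem_of_isTIdeal {I : Submodule F (FreeAlg F G)} (hI : IsTIdeal I)
    {f : FreeAlg F G} (hf : f ∈ I) {b : G × ℕ → FreeAlg F G}
    (hb : ∀ p, b p ∈ freeComponent F p.1) : evalHom (F := F) b f ∈ I :=
  hI.map_mem (evalHom (F := F) b)
    (fun g _ h => evalHom_mem (𝒜 := freeComponent F) freeComponent_mul_mem hb (g := g) h) hf

end Ideals

/-! ### Multilinear polynomials and their evaluations. -/

section Multilinear

variable {F : Type*} [Field F] {A : Type*} [NonUnitalRing A] [Module F A] [IsScalarTower F A A]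
  [SMulCommClass F A A]

theorem mem_multilinear_iff {G : Type*} {n : ℕ} {g : Fin (n + 1) → G} {f : FreeAlg F G} :
    f ∈ multilinear F g ↔
      ∃ c : Equiv.Perm (Fin (n + 1)) → F, f = ∑ σ, c σ • mono F (permWord g σ) := by
  have : {m | ∃ σ : Equiv.Perm (Fin (n + 1)), m = mono F (permWord g σ)} =
      Set.range fun σ => mono F (permWord g σ) := by
    ext m
    simp [eq_comm]
  rw [multilinear, this, Submodule.mem_span_range_iff_exists_fun]
  simp only [eq_comm]

theorem evalHom_permWord {G : Type*} {n : ℕ} (a : G × ℕ → A) (g : Fin (n + 1) → G)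
    (σ : Equiv.Perm (Fin (n + 1))) :
    evalHom (F := F) a (mono F (permWord g σ)) = nprod F n fun i => a (g (σ i), (σ i : ℕ)) := by
  rw [permWord_eq_tupleWord, evalHom_mono_tupleWord]
  rfl

theorem evalHom_sum_permWord {G : Type*} {n : ℕ} (a : G × ℕ → A) (g : Fin (n + 1) → G)
    (c : Equiv.Perm (Fin (n + 1)) → F) :
    evalHom (F := F) a (∑ σ, c σ • mono F (permWord g σ)) =
      ∑ σ, c σ • nprod F n fun i => a (g (σ i), (σ i : ℕ)) := by
  simp only [map_sum, map_smul, evalHom_permWord]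

/-- A family indexed by `Fin (n + 1)` as an assignment of values to the graded variables. -/
theorem exists_assignment {G : Type*} {𝒜 : G → Submodule F A} {n : ℕ} (g : Fin (n + 1) → G)
    (x : Fin (n + 1) → A) (hx : ∀ i, x i ∈ 𝒜 (g i)) :
    ∃ a : G × ℕ → A, (∀ p, a p ∈ 𝒜 p.1) ∧ ∀ i, a (g i, (i : ℕ)) = x i := by
  classical
  -- The remaining variables go to 0, which lies in every component. The index `i` keeps the
  -- variables apart even when degrees repeat.
  refine ⟨fun p => if h : ∃ i : Fin (n + 1), (g i, (i : ℕ)) = p then x h.choose else 0, ?_, ?_⟩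
  · intro p
    dsimp only
    split_ifs with h
    · have := hx h.choose
      rwa [show g h.choose = p.1 from congrArg Prod.fst h.choose_spec] at this
    · exact zero_mem _
  · intro i
    have h : ∃ j : Fin (n + 1), (g j, (j : ℕ)) = (g i, (i : ℕ)) := ⟨i, rfl⟩
    dsimp only
    rw [dif_pos h]
    congr 1
    exact Fin.ext (congrArg Prod.snd h.choose_spec)

theorem multilinearMap_mem_of_span {ι M N : Type*} [Fintype ι] [AddCommGroup M] [Module F M]
    [AddCommGroup N] [Module F N] (Ψ : MultilinearMap F (fun _ : ι => M) N) (X : ι → Set M)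
    (I : Submodule F N) (h : ∀ x : ι → M, (∀ i, x i ∈ X i) → Ψ x ∈ I) (x : ι → M)
    (hx : ∀ i, x i ∈ Submodule.span F (X i)) : Ψ x ∈ I := by
  classical
  -- Induction on the set of slots whose entries are only known to lie in the span; the other slots
  -- hold generators.
  have key : ∀ s : Finset ι, ∀ x : ι → M, (∀ i ∈ s, x i ∈ Submodule.span F (X i)) →
      (∀ i ∉ s, x i ∈ X i) → Ψ x ∈ I := by
    intro s
    induction s using Finset.induction_on with
    | empty => exact fun x _ hx => h x fun i => hx i (by simp)
    | insert j s hj ih =>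
      intro x hs hns
      have hu : ∀ y ∈ Submodule.span F (X j), Ψ (Function.update x j y) ∈ I := by
        intro y hy
        refine Submodule.span_induction ?_ ?_ ?_ ?_ hy
        · intro y hy
          apply ih
          · intro i hi
            rw [Function.update_of_ne (by rintro rfl; exact hj hi)]
            exact hs i (Finset.mem_insert_of_mem hi)
          · intro i hi
            by_cases hij : i = j
            · subst hij; simpa using hy
            · rw [Function.update_of_ne hij]
              exact hns i (by simp [hij, hi])
        · rw [Ψ.map_update_zero]; exact zero_mem _
        · intro y z _ _ hy hz
          rw [Ψ.map_update_add]; exact add_mem hy hz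
        · intro c y _ hy
          rw [Ψ.map_update_smul]; exact Submodule.smul_mem _ _ hy
      simpa using hu (x j) (hs j (Finset.mem_insert_self _ _))
  exact key Finset.univ x (fun i _ => hx i) (fun i hi => absurd (Finset.mem_univ i) hi)

theorem sum_nprod_mem_of_span {n : ℕ} (c : Equiv.Perm (Fin (n + 1)) → F)
    (X : Fin (n + 1) → Set A) (I : Submodule F A)
    (h : ∀ x : Fin (n + 1) → A, (∀ i, x i ∈ X i) → ∑ σ, c σ • nprod F n (x ∘ σ) ∈ I)
    (x : Fin (n + 1) → A) (hx : ∀ i, x i ∈ Submodule.span F (X i)) :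
    ∑ σ, c σ • nprod F n (x ∘ σ) ∈ I := by
  have key : ∀ x : Fin (n + 1) → A, (∑ σ, c σ • (nprod F n (A := A)).domDomCongr σ :
      MultilinearMap F (fun _ : Fin (n + 1) => A) A) x = ∑ σ, c σ • nprod F n (x ∘ σ) := by
    intro x
    rw [_root_.sum_apply]
    rfl
  rw [← key]
  exact multilinearMap_mem_of_span _ X I (fun x hx => by rw [key]; exact h x hx) x hx

end Multilinear

/-! ### The maps `phi` on multilinear polynomials. -/

section Phi

variable {F G H : Type*} [Field F] [CommGroup H] (β : SkewBicharacter F H)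

theorem varphi_mono_permWord (h : ℕ → H) {n : ℕ} (g : Fin (n + 1) → G)
    (σ : Equiv.Perm (Fin (n + 1))) :
    varphi F h (mono F (permWord g σ)) = mono F (permWord (fun i => (g i, h i)) σ) := by
  rw [varphi, evalHom_mono]
  have key : ∀ w : FreeSemigroup (G × ℕ),
      FreeSemigroup.lift (fun p : G × ℕ => var F (p.1, h p.2) p.2) w =
        mono F (FreeSemigroup.map (fun p : G × ℕ => ((p.1, h p.2), p.2)) w) := by
    intro w
    induction w with
    | ih1 x => rfl
    | ih2 x y _ hy => rw [map_mul, map_mul, mono_mul, hy]; rfl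
  rw [key, permWord_eq_tupleWord, map_tupleWord, permWord_eq_tupleWord]
  rfl

theorem phi_sum_permWord (h : ℕ → H) {n : ℕ} (g : Fin (n + 1) → G)
    (c : Equiv.Perm (Fin (n + 1)) → F) :
    phi β h (∑ σ, c σ • mono F (permWord g σ)) =
      ∑ σ, (c σ * (colorSign β (permWord (fun i : Fin (n + 1) => h i) σ) : F)) •
        mono F (permWord (fun i => (g i, h i)) σ) := by
  have hz : ∀ w : FreeSemigroup ((G × H) × ℕ),
      zeta β (mono F w) = (colorSign β (wordSnd w) : F) • mono F w := by
    intro w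
    have : mono F w = MonoidAlgebra.basis (FreeSemigroup ((G × H) × ℕ)) F w := by
      simp [mono]
    conv_lhs => rw [this]
    rw [zeta, Module.Basis.constr_basis]
  have hm : ∀ σ, phi β h (mono F (permWord g σ)) =
      (colorSign β (permWord (fun i : Fin (n + 1) => h i) σ) : F) •
        mono F (permWord (fun i => (g i, h i)) σ) := by
    intro σ
    change zeta β (varphi F h (mono F (permWord g σ))) = _
    rw [varphi_mono_permWord, hz, permWord_eq_tupleWord, wordSnd, map_tupleWord]
    rfl
  simp only [map_sum, map_smul, hm, smul_smul]

theorem extendTuple_apply {n : ℕ} (h : Fin n → H) (i : Fin n) : extendTuple h i = h i := by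
  simp [extendTuple]

end Phi

/-! ### Signs in color commutative algebras. -/

section Color

variable {F H : Type*} [Field F] [CommGroup H] {β : SkewBicharacter F H}
  {C : Type*} [NonUnitalRing C] [Module F C] [IsScalarTower F C C] [SMulCommClass F C C]
  {𝒞 : H → Submodule F C}

theorem colorIdeal_le_gradedIdentitiesMod
    (hm : ∀ {g h : H} {a b : C}, a ∈ 𝒞 g → b ∈ 𝒞 h → a * b ∈ 𝒞 (g * h))
    (hc : IsColorCommutative β 𝒞) : colorIdeal β ≤ gradedIdentitiesMod 𝒞 ⊥ := by
  apply tIdeal_le (isTIdeal_gradedIdentitiesMod hm (by simp) (by simp))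
  rintro _ ⟨h, k, i, j, rfl⟩ a ha
  rw [Submodule.mem_bot, map_sub, map_smul, map_mul, map_mul, evalHom_var, evalHom_var,
    hc h k _ (ha (h, i)) _ (ha (k, j)), sub_self]

/-- The indices in `permWord h σ` are distinct, so only one rearrangement is sorted. -/
theorem sortWord_permWord {n : ℕ} (h : Fin (n + 1) → H) (σ : Equiv.Perm (Fin (n + 1))) :
    sortWord (permWord h σ) = permWord h 1 := by
  have hp := sortWord_perm (permWord h σ)
  have hs : ((sortWord (permWord h σ)).head :: (sortWord (permWord h σ)).tail).Pairwise
      fun p q => p.2 ≤ q.2 := by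
    have hs := List.pairwise_insertionSort (fun p q : H × ℕ => p.2 ≤ q.2)
      ((permWord h σ).head :: (permWord h σ).tail)
    unfold sortWord
    split
    · rename_i heq
      have := (List.perm_insertionSort (fun p q : H × ℕ => p.2 ≤ q.2)
        ((permWord h σ).head :: (permWord h σ).tail)).length_eq
      rw [heq] at this
      simp at this
    · rename_i heq
      rwa [heq] at hs
  have hl : (permWord h 1).head :: (permWord h 1).tail =
      List.ofFn fun i : Fin (n + 1) => (h i, (i : ℕ)) := by
    rw [permWord_eq_tupleWord, head_cons_tail_tupleWord]; rfl
  have hσ : (permWord h σ).head :: (permWord h σ).tail =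
      List.ofFn ((fun i : Fin (n + 1) => (h i, (i : ℕ))) ∘ σ) := by
    rw [permWord_eq_tupleWord, head_cons_tail_tupleWord]; rfl
  have hp' := hp
  rw [hσ] at hp'
  have hp2 : ((sortWord (permWord h σ)).head :: (sortWord (permWord h σ)).tail).Perm
      (List.ofFn fun i : Fin (n + 1) => (h i, (i : ℕ))) :=
    hp'.trans (Equiv.Perm.ofFn_comp_perm σ _)
  have heq : (sortWord (permWord h σ)).head :: (sortWord (permWord h σ)).tail =
      (permWord h 1).head :: (permWord h 1).tail := by
    rw [hl]
    refine List.Perm.eq_of_pairwise ?_ hs ?_ hp2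
    · intro a b ha hb hab hba
      have ha' := hp2.subset ha
      rw [List.mem_ofFn] at ha' hb
      obtain ⟨i, rfl⟩ := ha'
      obtain ⟨j, rfl⟩ := hb
      have : i = j := Fin.ext (le_antisymm hab hba)
      rw [this]
    · rw [List.pairwise_ofFn]
      intro i j hij
      exact le_of_lt hij
  obtain ⟨h1, h2⟩ := List.cons.inj heq
  exact FreeSemigroup.ext h1 h2

/-- The relation that defines `colorSign` holds modulo `colorIdeal β`, which consists of identities
of `C`, so it may be evaluated at `x`. -/
theorem colorSign_smul_nprod
    (hm : ∀ {g h : H} {a b : C}, a ∈ 𝒞 g → b ∈ 𝒞 h → a * b ∈ 𝒞 (g * h))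
    (hc : IsColorCommutative β 𝒞) {n : ℕ} (h : Fin (n + 1) → H) {x : Fin (n + 1) → C}
    (hx : ∀ i, x i ∈ 𝒞 (h i)) (σ : Equiv.Perm (Fin (n + 1))) :
    (colorSign β (permWord h σ) : F) • nprod F n (x ∘ σ) = nprod F n x := by
  obtain ⟨a, ha, hax⟩ := exists_assignment h x hx
  have hs : colorMono β (sortWord (permWord h σ)) =
      (colorSign β (permWord h σ) : F) • colorMono β (permWord h σ) :=
    Classical.choose_spec (exists_colorSign β (permWord h σ))
  rw [sortWord_permWord, colorMono, colorMono, ← map_smul, ← sub_eq_zero, ← map_sub,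
    Submodule.mkQ_apply, Submodule.Quotient.mk_eq_zero] at hs
  have h0 := colorIdeal_le_gradedIdentitiesMod hm hc hs a ha
  rw [Submodule.mem_bot, map_sub, map_smul, evalHom_permWord, evalHom_permWord, sub_eq_zero] at h0
  simp only [hax, Equiv.Perm.one_apply] at h0
  exact h0.symm

end Color

/-! ### A color commutative algebra with nonzero multilinear monomials. -/

section Model

variable {F : Type u} {H : Type v} [Field F] [CommGroup H] (β : SkewBicharacter F H)
  {ι : Type v} [LinearOrder ι] (h : ι → H)

/-- The sign obtained on sorting the concatenation of two sorted square-free words with letter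
sets `S` and `T`; it is zero if these sets meet. -/
def colorCocycle (S T : Finset ι) : F :=
  if Disjoint S T then ∏ s ∈ S, ∏ t ∈ T, if t < s then (β.toFun (h s) (h t) : F) else 1 else 0

theorem colorCocycle_ne_zero {S T : Finset ι} (hST : Disjoint S T) :
    colorCocycle β h S T ≠ 0 := by
  rw [colorCocycle, if_pos hST]
  refine Finset.prod_ne_zero_iff.2 fun s _ => Finset.prod_ne_zero_iff.2 fun t _ => ?_
  split_ifs
  · exact Units.ne_zero _
  · exact one_ne_zero

/-- If two of the sets meet, both sides vanish; otherwise both are the product of the factors of the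
pairs from `S × T`, `S × U` and `T × U`. This is associativity of the model. -/
theorem colorCocycle_assoc (S T U : Finset ι) :
    colorCocycle β h S T * colorCocycle β h (S ∪ T) U =
      colorCocycle β h T U * colorCocycle β h S (T ∪ U) := by
  by_cases h1 : Disjoint S T <;> by_cases h2 : Disjoint S U <;> by_cases h3 : Disjoint T U <;>
    simp only [colorCocycle, h1, h2, h3, Finset.disjoint_union_left, Finset.disjoint_union_right,
      and_self, and_true, and_false, if_true, if_false, mul_zero, zero_mul]
  rw [Finset.prod_union h1]
  simp only [Finset.prod_union h3, Finset.prod_mul_distrib]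
  ring

theorem toFun_one_left (k : H) : β.toFun 1 k = 1 := by
  have := β.map_mul_left 1 1 k
  rw [mul_one] at this
  exact left_eq_mul.1 this

theorem toFun_prod_left (S : Finset ι) (k : H) :
    β.toFun (∏ s ∈ S, h s) k = ∏ s ∈ S, β.toFun (h s) k :=
  map_prod (⟨⟨fun g => β.toFun g k, toFun_one_left β k⟩, fun a b => β.map_mul_left a b k⟩ : H →* Fˣ)
    h S

theorem toFun_prod_right (T : Finset ι) (k : H) :
    β.toFun k (∏ t ∈ T, h t) = ∏ t ∈ T, β.toFun k (h t) := by
  rw [β.skew, toFun_prod_left, ← Finset.prod_inv_distrib]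
  exact Finset.prod_congr rfl fun t _ => (β.skew _ _).symm

theorem colorCocycle_comm (S T : Finset ι) :
    colorCocycle β h S T =
      β.toFun (∏ s ∈ S, h s) (∏ t ∈ T, h t) * colorCocycle β h T S := by
  by_cases hST : Disjoint S T
  · simp only [colorCocycle, hST, hST.symm, if_true]
    rw [toFun_prod_left, Finset.prod_comm (s := T)]
    simp only [toFun_prod_right, Units.coe_prod, ← Finset.prod_mul_distrib]
    -- Compared pair by pair: each pair is inverted on exactly one side, and skew-symmetry cancels
    -- the extra factor when `s < t`.
    refine Finset.prod_congr rfl fun s hs => Finset.prod_congr rfl fun t ht => ?_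
    rcases lt_trichotomy s t with hlt | rfl | hlt
    · rw [if_neg hlt.not_gt, if_pos hlt, β.skew (h s) (h t)]
      simp
    · exact absurd ht (Finset.disjoint_left.1 hST hs)
    · rw [if_pos hlt, if_neg hlt.not_gt, mul_one]
  · rw [colorCocycle, colorCocycle, if_neg hST, if_neg fun hTS => hST hTS.symm, mul_zero]

/-- The color commutative algebra on generators `e_i`, `i ∈ ι`, of degree `h i`
and square zero: its basis consists of the products of the `e_i` over finite subsets of `ι`. -/
def ColorModel (_ : SkewBicharacter F H) (_ : ι → H) : Type (max u v) := Finset ι →₀ F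

namespace ColorModel

instance : AddCommGroup (ColorModel β h) := inferInstanceAs (AddCommGroup (Finset ι →₀ F))

instance : Module F (ColorModel β h) := inferInstanceAs (Module F (Finset ι →₀ F))

/-- The basis vector of `S`. -/
def basisVec (S : Finset ι) : ColorModel β h := Finsupp.single S (1 : F)

/-- The multiplication of the model. -/
def mulHom : ColorModel β h →ₗ[F] ColorModel β h →ₗ[F] ColorModel β h :=
  Finsupp.linearCombination F (M := (Finset ι →₀ F) →ₗ[F] ColorModel β h) fun S : Finset ι =>
    Finsupp.linearCombination F fun T => colorCocycle β h S T • basisVec β h (S ∪ T)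

theorem mulHom_basisVec (S T : Finset ι) :
    mulHom β h (basisVec β h S) (basisVec β h T) =
      colorCocycle β h S T • basisVec β h (S ∪ T) := by
  rw [mulHom, basisVec]
  erw [Finsupp.linearCombination_single, one_smul, basisVec, Finsupp.linearCombination_single,
    one_smul]

variable {β h} in
theorem induction_basisVec {p : ColorModel β h → Prop} (x : ColorModel β h) (h0 : p 0)
    (hadd : ∀ x y, p x → p y → p (x + y)) (hsm : ∀ (c : F) S, p (c • basisVec β h S)) : p x := by
  refine Finsupp.induction_linear (motive := p) x h0 hadd fun S c => ?_
  have : (Finsupp.single S c : Finset ι →₀ F) = c • Finsupp.single S (1 : F) := by simp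
  rw [this]
  exact hsm c S

theorem mulHom_assoc (x y z : ColorModel β h) :
    mulHom β h (mulHom β h x y) z = mulHom β h x (mulHom β h y z) := by
  induction x using induction_basisVec with
  | h0 => simp
  | hadd x x' hx hx' => simp only [map_add, LinearMap.add_apply, hx, hx']
  | hsm a S =>
    induction y using induction_basisVec with
    | h0 => simp
    | hadd x x' hx hx' => simp only [map_add, LinearMap.add_apply, hx, hx']
    | hsm b T =>
      induction z using induction_basisVec with
      | h0 => simp
      | hadd x x' hx hx' => simp only [map_add, hx, hx']
      | hsm c U =>
        simp only [map_smul, LinearMap.smul_apply, mulHom_basisVec, smul_smul]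
        rw [Finset.union_assoc]
        congr 1
        linear_combination c * b * a * colorCocycle_assoc β h S T U

instance : NonUnitalRing (ColorModel β h) where
  mul x y := mulHom β h x y
  left_distrib x y z := (mulHom β h x).map_add y z
  right_distrib x y z := by
    change mulHom β h (x + y) z = mulHom β h x z + mulHom β h y z
    rw [map_add, LinearMap.add_apply]
  zero_mul x := by
    change mulHom β h 0 x = 0
    rw [map_zero, LinearMap.zero_apply]
  mul_zero x := (mulHom β h x).map_zero
  mul_assoc := mulHom_assoc β h

theorem mul_def (x y : ColorModel β h) : x * y = mulHom β h x y := rfl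

instance : IsScalarTower F (ColorModel β h) (ColorModel β h) where
  smul_assoc c x y := by
    simp only [smul_eq_mul, mul_def, map_smul, LinearMap.smul_apply]

instance : SMulCommClass F (ColorModel β h) (ColorModel β h) where
  smul_comm c x y := by
    simp only [smul_eq_mul, mul_def, map_smul]

theorem basisVec_mul (S T : Finset ι) :
    basisVec β h S * basisVec β h T = colorCocycle β h S T • basisVec β h (S ∪ T) :=
  mulHom_basisVec β h S T

theorem basisVec_ne_zero (S : Finset ι) : basisVec β h S ≠ 0 :=
  Finsupp.single_ne_zero.2 one_ne_zero

/-- The grading of the model, by the product of the degrees of the generators. -/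
def component (k : H) : Submodule F (ColorModel β h) :=
  Finsupp.supported F F {S : Finset ι | ∏ s ∈ S, h s = k}

theorem component_eq_span (k : H) :
    component β h k = Submodule.span F (basisVec β h '' {S | ∏ s ∈ S, h s = k}) :=
  Finsupp.supported_eq_span_single F _

theorem iSupIndep_supported_fiber {α K : Type*} (d : α → K) :
    iSupIndep fun k => Finsupp.supported F F {a | d a = k} := by
  intro k
  have hle : ⨆ j, ⨆ (_ : j ≠ k), Finsupp.supported F F {a | d a = j} ≤
      Finsupp.supported F F {a | d a = k}ᶜ :=
    iSup₂_le fun j hj => Finsupp.supported_mono fun a ha hk => hj (ha.symm.trans hk)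
  exact (Finsupp.disjoint_supported_supported
    disjoint_compl_right).mono_right hle

theorem iSup_supported_fiber {α K : Type*} (d : α → K) :
    ⨆ k, Finsupp.supported F F {a | d a = k} = ⊤ := by
  rw [← Finsupp.supported_iUnion]
  have : (⋃ k : K, {a | d a = k}) = Set.univ := by
    ext a; simp
  rw [this, Finsupp.supported_univ]

theorem isGrading_component : IsGrading (component β h) where
  indep := iSupIndep_supported_fiber fun S : Finset ι => ∏ s ∈ S, h s
  iSup_eq_top := iSup_supported_fiber fun S : Finset ι => ∏ s ∈ S, h s
  mul_mem := by
    intro g k a b ha hb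
    rw [component_eq_span] at ha hb
    rw [mul_def]
    refine LinearMap.BilinMap.apply_apply_mem_of_mem_span (component β h (g * k)) _ _
      (mulHom β h) ?_ a b ha hb
    rintro _ ⟨S, hS, rfl⟩ _ ⟨T, hT, rfl⟩
    rw [mulHom_basisVec]
    by_cases hST : Disjoint S T
    · apply Submodule.smul_mem
      rw [component_eq_span]
      refine Submodule.subset_span ⟨_, ?_, rfl⟩
      exact (Finset.prod_union hST).trans (congrArg₂ (· * ·) hS hT)
    · rw [colorCocycle, if_neg hST, zero_smul]
      exact zero_mem _

theorem isColorCommutative_component : IsColorCommutative β (component β h) := by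
  intro g k a ha b hb
  rw [component_eq_span] at ha hb
  rw [← sub_eq_zero, mul_def, mul_def]
  have := LinearMap.BilinMap.apply_apply_mem_of_mem_span (⊥ : Submodule F (ColorModel β h)) _ _
      (mulHom β h - (β.toFun g k : F) • (mulHom β h).flip) ?_ a b ha hb
  · simpa using this
  rintro _ ⟨S, rfl, rfl⟩ _ ⟨T, rfl, rfl⟩
  simp only [LinearMap.sub_apply, LinearMap.smul_apply, LinearMap.flip_apply, mulHom_basisVec,
    Submodule.mem_bot, smul_smul]
  rw [colorCocycle_comm, Finset.union_comm, sub_self]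

/-- With distinct letters every multiplication joins disjoint sets, so no cocycle value that occurs
is zero. -/
theorem lift_basisVec (w : FreeSemigroup ι) (hw : (w.head :: w.tail).Nodup) :
    ∃ c : F, c ≠ 0 ∧ FreeSemigroup.lift (fun i => basisVec β h {i}) w =
      c • basisVec β h (w.head :: w.tail).toFinset := by
  induction w with
  | ih1 x => exact ⟨1, one_ne_zero, by simp⟩
  | ih2 x y _ ih =>
    have hw' : (x :: y.head :: y.tail).Nodup := hw
    rw [List.nodup_cons] at hw'
    obtain ⟨c, hc, hy⟩ := ih hw'.2
    refine ⟨c * colorCocycle β h {x} (y.head :: y.tail).toFinset,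
      mul_ne_zero hc (colorCocycle_ne_zero β h ?_), ?_⟩
    · rw [Finset.disjoint_singleton_left, List.mem_toFinset]
      exact hw'.1
    · rw [map_mul, hy, FreeSemigroup.lift_of, mul_smul_comm, basisVec_mul, smul_smul]
      congr 2
      ext z
      simp [or_left_comm]

end ColorModel

/-- No multilinear monomial is an identity of all color commutative algebras. -/
theorem exists_color_model {n : ℕ} (h : Fin (n + 1) → H) :
    ∃ (A : Type (max u v)) (_ : NonUnitalRing A) (_ : Module F A) (_ : IsScalarTower F A A)
      (_ : SMulCommClass F A A) (𝒜 : H → Submodule F A),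
      IsGrading 𝒜 ∧ IsColorCommutative β 𝒜 ∧
        ∃ x : Fin (n + 1) → A, (∀ i, x i ∈ 𝒜 (h i)) ∧ nprod F n x ≠ 0 := by
  -- The lift places the model in the universe over which `GeneratesColorVariety` quantifies.
  let h' : ULift.{v} (Fin (n + 1)) → H := fun i => h i.down
  refine ⟨ColorModel β h', inferInstance, inferInstance, inferInstance, inferInstance,
    ColorModel.component β h', ColorModel.isGrading_component β h',
    ColorModel.isColorCommutative_component β h', fun i => ColorModel.basisVec β h' {⟨i⟩}, ?_, ?_⟩
  · intro i
    rw [ColorModel.component_eq_span]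
    exact Submodule.subset_span ⟨_, by simp [h'], rfl⟩
  · obtain ⟨c, hc, hw⟩ := ColorModel.lift_basisVec β h'
      (tupleWord fun i : Fin (n + 1) => (⟨i⟩ : ULift.{v} (Fin (n + 1)))) (by
        rw [head_cons_tail_tupleWord, List.nodup_ofFn]
        exact fun i j hij => congrArg ULift.down hij)
    rw [lift_tupleWord (F := F)] at hw
    exact hw.trans_ne (smul_ne_zero hc (ColorModel.basisVec_ne_zero β h' _))

end Model

/-! ### The inverse bicharacter. -/

section Inverse

variable {F : Type u} {H : Type v} [Field F] [CommGroup H] (β : SkewBicharacter F H)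

/-- The inverse of a skew-symmetric bicharacter. -/
def SkewBicharacter.inv : SkewBicharacter F H where
  toFun g h := (β.toFun g h)⁻¹
  map_mul_left g h k := by rw [β.map_mul_left, mul_inv]
  map_mul_right g h k := by rw [β.map_mul_right, mul_inv]
  skew g h := by rw [β.skew]

variable {β} {C D : Type*} [NonUnitalRing C] [Module F C] [IsScalarTower F C C]
  [SMulCommClass F C C] [NonUnitalRing D] [Module F D] [IsScalarTower F D D] [SMulCommClass F D D]
  {𝒞 : H → Submodule F C} {𝒟 : H → Submodule F D}

/-- Each swap of neighbours costs a value of `β` in `C` and its inverse in `D`, so the same chain of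
swaps yields inverse scalars. The products are taken in the unitization because the induction starts
at the empty list. -/
theorem exists_sign_of_perm (hc : IsColorCommutative β 𝒞) (hd : IsColorCommutative β.inv 𝒟)
    {L : Type*} {d : L → H} {x : L → C} {y : L → D} (hx : ∀ i, x i ∈ 𝒞 (d i))
    (hy : ∀ i, y i ∈ 𝒟 (d i)) {l l' : List L} (hl : l.Perm l') :
    ∃ c : Fˣ, (l.map fun i => (Unitization.inr (x i) : Unitization F C)).prod =
        (c : F) • (l'.map fun i => (Unitization.inr (x i) : Unitization F C)).prod ∧
      (l.map fun i => (Unitization.inr (y i) : Unitization F D)).prod =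
        ((c⁻¹ : Fˣ) : F) • (l'.map fun i => (Unitization.inr (y i) : Unitization F D)).prod := by
  induction hl with
  | nil => exact ⟨1, by simp, by simp⟩
  | cons i _ ih =>
    obtain ⟨c, h1, h2⟩ := ih
    refine ⟨c, ?_, ?_⟩
    · rw [List.map_cons, List.prod_cons, h1, List.map_cons, List.prod_cons, mul_smul_comm]
    · rw [List.map_cons, List.prod_cons, h2, List.map_cons, List.prod_cons, mul_smul_comm]
  | swap i j l =>
    refine ⟨β.toFun (d j) (d i), ?_, ?_⟩
    · simp only [List.map_cons, List.prod_cons, ← mul_assoc, ← Unitization.inr_mul]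
      rw [hc _ _ _ (hx j) _ (hx i), Unitization.inr_smul, smul_mul_assoc]
    · simp only [List.map_cons, List.prod_cons, ← mul_assoc, ← Unitization.inr_mul]
      rw [hd _ _ _ (hy j) _ (hy i), Unitization.inr_smul, smul_mul_assoc]
      rfl
  | trans _ _ ih1 ih2 =>
    obtain ⟨c, h1, h2⟩ := ih1
    obtain ⟨e, h3, h4⟩ := ih2
    refine ⟨c * e, ?_, ?_⟩
    · rw [h1, h3, smul_smul, Units.val_mul]
    · rw [h2, h4, smul_smul, mul_inv, Units.val_mul]

theorem nprod_comp_eq_colorSign_smul (hd : IsColorCommutative β.inv 𝒟) {n : ℕ}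
    (h : Fin (n + 1) → H) {y : Fin (n + 1) → D} (hy : ∀ i, y i ∈ 𝒟 (h i))
    (σ : Equiv.Perm (Fin (n + 1))) :
    nprod F n (y ∘ σ) = (colorSign β (permWord h σ) : F) • nprod F n y := by
  -- A nonzero product in a `β`-commutative algebra identifies the scalar `c` of the rearrangement
  -- as the inverse of `colorSign`.
  obtain ⟨A, _, _, _, _, 𝒜, hA, hAc, x, hx, hx0⟩ := exists_color_model β h
  obtain ⟨c, h1, h2⟩ := exists_sign_of_perm hAc hd hx hy
    (Equiv.Perm.ofFn_comp_perm σ (id : Fin (n + 1) → Fin (n + 1)))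
  simp only [List.map_ofFn] at h1 h2
  have h1' : nprod F n (x ∘ σ) = (c : F) • nprod F n x := by
    apply Unitization.inr_injective (R := F)
    rw [Unitization.inr_smul, inr_nprod, inr_nprod]
    exact h1
  have h2' : nprod F n (y ∘ σ) = ((c⁻¹ : Fˣ) : F) • nprod F n y := by
    apply Unitization.inr_injective (R := F)
    rw [Unitization.inr_smul, inr_nprod, inr_nprod]
    exact h2
  have h3 := colorSign_smul_nprod hA.mul_mem hAc h hx σ
  rw [h1', smul_smul] at h3
  have h4 : (colorSign β (permWord h σ) : F) * c = 1 := by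
    have : ((colorSign β (permWord h σ) : F) * c - 1) • nprod F n x = 0 := by
      rw [sub_smul, h3, one_smul, sub_self]
    exact sub_eq_zero.1 ((smul_eq_zero.1 this).resolve_right hx0)
  rw [h2', Units.val_inv_eq_inv_val, ← eq_inv_of_mul_eq_one_left h4]

end Inverse

/-! ### Linearization in characteristic zero. -/

section Multilinearization

variable {F : Type*} [Field F]

/-- The bounds may be enlarged at will, so that they can later include a prescribed tuple of
letters. -/
theorem exists_eq_sum_tupleWord {L : Type*} (f : MonoidAlgebra F (FreeSemigroup L)) :
    ∃ (N₀ : ℕ) (X₀ : Finset L), ∀ N, N₀ ≤ N → ∀ X, X₀ ⊆ X → f = ∑ m ∈ Finset.range N,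
      ∑ s ∈ Fintype.piFinset fun _ : Fin (m + 1) => X,
        MonoidAlgebra.single (tupleWord s) (f.coeff (tupleWord s)) := by
  classical
  refine ⟨f.coeff.support.sup FreeSemigroup.length,
    f.coeff.support.biUnion fun w => (w.head :: w.tail).toFinset, fun N hN X hX => ?_⟩
  let Z : Finset (Σ m, Fin (m + 1) → L) :=
    (Finset.range N).sigma fun m => Fintype.piFinset fun _ : Fin (m + 1) => X
  have hZ : f.coeff.support ⊆ Z.image fun p => tupleWord p.2 := by
    intro w hw
    obtain ⟨m, s, rfl⟩ := exists_tupleWord w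
    refine Finset.mem_image.2 ⟨⟨m, s⟩, Finset.mem_sigma.2 ⟨?_, ?_⟩, rfl⟩
    · have h1 : (tupleWord s).length ≤ N := (Finset.le_sup hw).trans hN
      rw [FreeSemigroup.length] at h1
      simpa [tupleWord] using h1
    · rw [Fintype.mem_piFinset]
      intro i
      refine hX (Finset.mem_biUnion.2 ⟨_, hw, ?_⟩)
      rw [head_cons_tail_tupleWord, List.mem_toFinset, List.mem_ofFn]
      exact ⟨i, rfl⟩
  rw [Finset.sum_sigma' (Finset.range N) (fun m => Fintype.piFinset fun _ : Fin (m + 1) => X)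
    fun m s => MonoidAlgebra.single (tupleWord s) (f.coeff (tupleWord s))]
  conv_lhs => rw [← f.sum_coeff_single, Finsupp.sum, Finset.sum_subset hZ (fun w _ hw => by
    rw [Finsupp.notMem_support_iff.1 hw, MonoidAlgebra.single_zero])]
  exact Finset.sum_image fun p _ q _ hpq => tupleWord_injective hpq

/-- Extracting the coefficient of `X 0 ⋯ X n` selects the permutations among all index maps `r`. -/
theorem coeff_prod_X {n m : ℕ} (r : Fin (m + 1) → Fin (n + 1)) :
    MvPolynomial.coeff (∑ i : Fin (n + 1), Finsupp.single i 1)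
      (∏ j, MvPolynomial.X (R := F) (r j)) = if Function.Bijective r then 1 else 0 := by
  have hr : (∏ j, MvPolynomial.X (R := F) (r j)) =
      MvPolynomial.monomial (∑ j, Finsupp.single (r j) 1) 1 := by
    simp only [MvPolynomial.X]
    rw [MvPolynomial.monomial_sum_one]
  rw [hr, MvPolynomial.coeff_monomial]
  congr 1
  rw [eq_iff_iff]
  constructor
  · intro h
    have hcard : m = n := by
      have := congrArg Finsupp.degree h
      simpa using this
    subst hcard
    refine Finite.surjective_iff_bijective.1 fun i => ?_
    by_contra hi
    have := DFunLike.congr_fun h i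
    simp only [Finsupp.finsetSum_apply, Finsupp.single_apply] at this
    rw [Finset.sum_eq_zero fun j _ => if_neg fun hj => hi ⟨j, hj⟩] at this
    simp at this
  · intro h
    exact Fintype.sum_bijective r h _ _ fun _ => rfl

/-- The multilinear coefficient of a vanishing polynomial with vector coefficients vanishes. -/
theorem sum_perm_eq_zero_of_forall [Infinite F] {V : Type*} [AddCommGroup V] [Module F V]
    {n N : ℕ} (hn : n < N) (v : ∀ m, (Fin (m + 1) → Fin (n + 1)) → V)
    (hv : ∀ t : Fin (n + 1) → F,
      ∑ m ∈ Finset.range N, ∑ r : Fin (m + 1) → Fin (n + 1), (∏ j, t (r j)) • v m r = 0) :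
    ∑ σ : Equiv.Perm (Fin (n + 1)), v n σ = 0 := by
  classical
  rw [← Module.forall_dual_apply_eq_zero_iff F]
  intro φ
  let p : MvPolynomial (Fin (n + 1)) F := ∑ m ∈ Finset.range N,
    ∑ r : Fin (m + 1) → Fin (n + 1), φ (v m r) • ∏ j, MvPolynomial.X (r j)
  have hp : p = 0 := by
    apply MvPolynomial.funext
    intro t
    have := congrArg φ (hv t)
    simp only [map_sum, map_smul, map_zero, smul_eq_mul] at this
    simp only [p, map_sum, MvPolynomial.smul_eval, map_prod, MvPolynomial.eval_X, map_zero]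
    rw [← this]
    simp only [mul_comm]
  have hc := congrArg (MvPolynomial.coeff (∑ i : Fin (n + 1), Finsupp.single i 1)) hp
  simp only [p, MvPolynomial.coeff_sum, MvPolynomial.coeff_smul, coeff_prod_X,
    MvPolynomial.coeff_zero, smul_eq_mul, mul_ite, mul_one, mul_zero] at hc
  rw [Finset.sum_eq_single n] at hc
  · rw [map_sum, ← hc, ← Finset.sum_filter]
    refine Finset.sum_bij (fun σ _ => (σ : Fin (n + 1) → Fin (n + 1))) ?_ ?_ ?_ ?_
    · intro σ _
      exact Finset.mem_filter.2 ⟨Finset.mem_univ _, σ.bijective⟩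
    · intro σ _ τ _ h
      exact DFunLike.coe_injective h
    · intro r hr
      exact ⟨Equiv.ofBijective r (Finset.mem_filter.1 hr).2, Finset.mem_univ _, rfl⟩
    · intro σ _
      rfl
  · intro m _ hm
    refine Finset.sum_eq_zero fun r _ => if_neg fun h => hm ?_
    simpa using Fintype.card_of_bijective h
  · intro h
    exact absurd (Finset.mem_range.2 hn) h

variable {G : Type*} [Group G] {A : Type*} [NonUnitalRing A] [Module F A]
  [IsScalarTower F A A] [SMulCommClass F A A]

/-- The complete linearization of `f` along the word of the tuple `s`. -/
def linearization (f : FreeAlg F G) {n : ℕ} (s : Fin (n + 1) → G × ℕ) : FreeAlg F G :=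
  ∑ σ : Equiv.Perm (Fin (n + 1)),
    f.coeff (tupleWord (s ∘ σ)) • mono F (permWord (fun i => (s i).1) σ)

theorem linearization_mem_multilinear (f : FreeAlg F G) {n : ℕ} (s : Fin (n + 1) → G × ℕ) :
    linearization f s ∈ multilinear F fun i => (s i).1 :=
  mem_multilinear_iff.2 ⟨_, rfl⟩

theorem linearization_mem_gradedIdentities [Infinite F] {𝒜 : G → Submodule F A} {f : FreeAlg F G}
    (hf : f ∈ gradedIdentities 𝒜) {n : ℕ} (s : Fin (n + 1) → G × ℕ) :
    linearization f s ∈ gradedIdentities 𝒜 := by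
  classical
  intro b hb
  obtain ⟨N₀, X₀, hX₀⟩ := exists_eq_sum_tupleWord f
  let N := max N₀ (n + 1)
  let X := X₀ ∪ Finset.univ.image s
  let a : Fin (n + 1) → A := fun i => b ((s i).1, (i : ℕ))
  rw [linearization, evalHom_sum_permWord]
  -- Each variable `y` is replaced by the sum of `t i • a i` over all `i` with `s i = y`. The value
  -- of `f` is polynomial in `t`, and its coefficient at `t 0 ⋯ t n` is the value of the
  -- linearization at `a`.
  refine sum_perm_eq_zero_of_forall (F := F) (n := n) (N := N) (lt_of_lt_of_le n.lt_succ_self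
    (le_max_right _ _)) (fun m r => f.coeff (tupleWord (s ∘ r)) • nprod F m (A := A) (a ∘ r)) fun t => ?_
  have ht : ∀ y, ∑ i, (if s i = y then t i else 0) • a i ∈ 𝒜 y.1 := by
    intro y
    refine Submodule.sum_mem _ fun i _ => ?_
    split_ifs with h
    · exact Submodule.smul_mem _ _ (h ▸ hb ((s i).1, (i : ℕ)))
    · rw [zero_smul]; exact zero_mem _
  have h0 := hf _ ht
  conv_lhs at h0 => rw [hX₀ N (le_max_left _ _) X Finset.subset_union_left]
  rw [map_sum] at h0
  rw [← h0]
  refine Finset.sum_congr rfl fun m _ => ?_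
  rw [map_sum]
  have hs : ∀ s' : Fin (m + 1) → G × ℕ,
      evalHom (F := F) (fun y => ∑ i, (if s i = y then t i else 0) • a i)
        (MonoidAlgebra.single (tupleWord s') (f.coeff (tupleWord s'))) =
      ∑ r : Fin (m + 1) → Fin (n + 1), (if s ∘ r = s' then
        (∏ j, t (r j)) • f.coeff (tupleWord (s ∘ r)) • nprod F m (a ∘ r) else 0) := by
    intro s'
    have h1 : (MonoidAlgebra.single (tupleWord s') (f.coeff (tupleWord s')) : FreeAlg F G) =
        f.coeff (tupleWord s') • mono F (tupleWord s') := by simp [mono]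
    rw [h1, map_smul, evalHom_mono_tupleWord]
    have h2 := (nprod F m (A := A)).map_sum
      (fun (j : Fin (m + 1)) (i : Fin (n + 1)) => (if s i = s' j then t i else 0) • a i)
    change nprod F m _ = _ at h2
    rw [show ((fun y => ∑ i, (if s i = y then t i else 0) • a i) ∘ s') =
      fun j => ∑ i, (if s i = s' j then t i else 0) • a i from rfl, h2, Finset.smul_sum]
    refine Finset.sum_congr rfl fun r _ => ?_
    rw [(nprod F m (A := A)).map_smul_univ (fun j => if s (r j) = s' j then t (r j) else 0)]
    split_ifs with h
    · subst h
      simp only [Function.comp_apply, if_true]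
      rw [smul_comm]
      rfl
    · obtain ⟨j, hj⟩ := Function.ne_iff.1 h
      rw [Finset.prod_eq_zero (Finset.mem_univ j) (if_neg hj), zero_smul, smul_zero]
  simp only [hs]
  rw [Finset.sum_comm]
  refine Finset.sum_congr rfl fun r _ => ?_
  rw [Finset.sum_ite_eq, if_pos]
  exact Fintype.mem_piFinset.2 fun j =>
    Finset.mem_union_right _ (Finset.mem_image_of_mem s (Finset.mem_univ (r j)))

/-- In characteristic zero, the graded identities of an algebra follow from the multilinear ones. -/
theorem gradedIdentities_subset_of_multilinear [CharZero F] {𝒜 : G → Submodule F A}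
    {I : Submodule F (FreeAlg F G)} (hI : IsTIdeal I)
    (h : ∀ (n : ℕ) (g : Fin (n + 1) → G), ∀ f ∈ multilinear F g, f ∈ gradedIdentities 𝒜 → f ∈ I) :
    gradedIdentities 𝒜 ⊆ I := by
  intro f hf
  obtain ⟨N, X, hX⟩ := exists_eq_sum_tupleWord f
  rw [SetLike.mem_coe, hX N le_rfl X subset_rfl]
  refine Submodule.sum_mem _ fun n _ => ?_
  let q : (Fin (n + 1) → G × ℕ) → FreeAlg F G := fun s =>
    MonoidAlgebra.single (tupleWord s) (f.coeff (tupleWord s))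
  -- Substituting the variable `s i` back for the `i`-th variable of the linearization gives the sum
  -- of the terms of `f` over all rearrangements of `s`.
  have hq : ∀ s, ∑ σ : Equiv.Perm (Fin (n + 1)), q (s ∘ σ) ∈ I := by
    intro s
    have hl := h n _ _ (linearization_mem_multilinear f s)
      (linearization_mem_gradedIdentities hf s)
    obtain ⟨b, hb, hbs⟩ := exists_assignment (𝒜 := freeComponent F) (fun i => (s i).1)
      (fun i => var F (s i).1 (s i).2) fun i => var_mem_freeComponent _ _
    have hm := evalHom_mem_of_isTIdeal hI hl hb
    rw [linearization, evalHom_sum_permWord] at hm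
    convert hm using 2 with σ
    simp only [hbs]
    have := evalHom_mono_tupleWord (F := F) (fun p : G × ℕ => var F p.1 p.2) (s ∘ σ)
    rw [evalHom_var_eq] at this
    rw [show (fun i => var F (s (σ i)).1 (s (σ i)).2) =
      (fun p : G × ℕ => var F p.1 p.2) ∘ (s ∘ σ) from rfl, ← this]
    simp [q, mono]
  -- Summed over all `s`, each rearrangement contributes the same total, so the part of `f` of
  -- length `n + 1` appears `(n + 1)!` times; this factor is invertible.
  have hsum : ∑ s ∈ Fintype.piFinset (fun _ : Fin (n + 1) => X),
      ∑ σ : Equiv.Perm (Fin (n + 1)), q (s ∘ σ) =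
        ((n + 1).factorial : F) • ∑ s ∈ Fintype.piFinset (fun _ : Fin (n + 1) => X), q s := by
    rw [Finset.sum_comm]
    have hσ : ∀ σ : Equiv.Perm (Fin (n + 1)),
        ∑ s ∈ Fintype.piFinset (fun _ : Fin (n + 1) => X), q (s ∘ σ) =
          ∑ s ∈ Fintype.piFinset (fun _ : Fin (n + 1) => X), q s := by
      intro σ
      refine Finset.sum_nbij' (fun s => s ∘ σ) (fun s => s ∘ σ.symm) ?_ ?_ ?_ ?_ ?_
      · exact fun s hs => Fintype.mem_piFinset.2 fun j => Fintype.mem_piFinset.1 hs (σ j)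
      · exact fun s hs => Fintype.mem_piFinset.2 fun j => Fintype.mem_piFinset.1 hs (σ.symm j)
      · intro s _; ext1 j; simp
      · intro s _; ext1 j; simp
      · intro s _; rfl
    rw [Finset.sum_congr rfl fun σ _ => hσ σ, Finset.sum_const, Finset.card_univ,
      Fintype.card_perm, Fintype.card_fin, Nat.cast_smul_eq_nsmul]
  have hmem := Submodule.sum_mem I
    (t := Fintype.piFinset (fun _ : Fin (n + 1) => X)) fun s _ => hq s
  rw [hsum] at hmem
  exact (Submodule.smul_mem_iff _ (Nat.cast_ne_zero.2 (Nat.factorial_ne_zero _))).1 hmem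

end Multilinearization

/-! ### Tensor products and the generating set. -/

section Main

variable {F : Type*} [Field F] {G : Type*} [Group G] {H : Type*} [CommGroup H]
  {β : SkewBicharacter F H}

theorem phi_extendTuple_sum_permWord {n : ℕ} (g : Fin (n + 1) → G) (h : Fin (n + 1) → H)
    (c : Equiv.Perm (Fin (n + 1)) → F) :
    phi β (extendTuple h) (∑ σ, c σ • mono F (permWord g σ)) =
      ∑ σ, (c σ * (colorSign β (permWord h σ) : F)) •
        mono F (permWord (fun i => (g i, h i)) σ) := by
  rw [phi_sum_permWord]
  simp only [extendTuple_apply]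

theorem phi_mem_multilinear (h : ℕ → H) {n : ℕ} {g : Fin (n + 1) → G} {f : FreeAlg F G}
    (hf : f ∈ multilinear F g) : phi β h f ∈ multilinear F fun i => (g i, h i) := by
  obtain ⟨c, rfl⟩ := mem_multilinear_iff.1 hf
  rw [phi_sum_permWord]
  exact mem_multilinear_iff.2 ⟨_, rfl⟩

section Tensor

variable {R C : Type*} [NonUnitalRing R] [Module F R] [IsScalarTower F R R] [SMulCommClass F R R]
  [NonUnitalRing C] [Module F C] [IsScalarTower F C C] [SMulCommClass F C C]

theorem tensorGrading_mul_mem {ℛ : G → Submodule F R} {𝒞 : H → Submodule F C}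
    (hℛ : ∀ {g h : G} {a b : R}, a ∈ ℛ g → b ∈ ℛ h → a * b ∈ ℛ (g * h))
    (h𝒞 : ∀ {g h : H} {a b : C}, a ∈ 𝒞 g → b ∈ 𝒞 h → a * b ∈ 𝒞 (g * h))
    {p q : G × H} {x y : R ⊗[F] C} (hx : x ∈ tensorGrading ℛ 𝒞 p) (hy : y ∈ tensorGrading ℛ 𝒞 q) :
    x * y ∈ tensorGrading ℛ 𝒞 (p * q) := by
  refine LinearMap.BilinMap.apply_apply_mem_of_mem_span (tensorGrading ℛ 𝒞 (p * q)) _ _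
    (LinearMap.mul F (R ⊗[F] C)) ?_ x y hx hy
  rintro _ ⟨r, hr, c, hc, rfl⟩ _ ⟨r', hr', c', hc', rfl⟩
  rw [LinearMap.mul_apply_apply, Algebra.TensorProduct.tmul_mul_tmul]
  exact Submodule.subset_span ⟨_, hℛ hr hr', _, h𝒞 hc hc', rfl⟩

/-- The elements of `R ⊗ C` of total degree `g` with respect to a `G × H`-grading of `R` and an
`H`-grading of `C` that are matched along `H`. -/
def matchedGrading (ℛ : G × H → Submodule F R) (𝒞 : H → Submodule F C) (g : G) :
    Submodule F (R ⊗[F] C) :=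
  Submodule.span F {t | ∃ h, ∃ r ∈ ℛ (g, h), ∃ c ∈ 𝒞 h, t = r ⊗ₜ[F] c}

theorem matchedGrading_mul_mem {ℛ : G × H → Submodule F R} {𝒞 : H → Submodule F C}
    (hℛ : ∀ {g h : G × H} {a b : R}, a ∈ ℛ g → b ∈ ℛ h → a * b ∈ ℛ (g * h))
    (h𝒞 : ∀ {g h : H} {a b : C}, a ∈ 𝒞 g → b ∈ 𝒞 h → a * b ∈ 𝒞 (g * h))
    {p q : G} {x y : R ⊗[F] C} (hx : x ∈ matchedGrading ℛ 𝒞 p) (hy : y ∈ matchedGrading ℛ 𝒞 q) :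
    x * y ∈ matchedGrading ℛ 𝒞 (p * q) := by
  refine LinearMap.BilinMap.apply_apply_mem_of_mem_span (matchedGrading ℛ 𝒞 (p * q)) _ _
    (LinearMap.mul F (R ⊗[F] C)) ?_ x y hx hy
  rintro _ ⟨h, r, hr, c, hc, rfl⟩ _ ⟨k, r', hr', c', hc', rfl⟩
  rw [LinearMap.mul_apply_apply, Algebra.TensorProduct.tmul_mul_tmul]
  exact Submodule.subset_span ⟨h * k, _, hℛ hr hr', _, h𝒞 hc hc', rfl⟩

/-- The image of `I ⊗ C` in `R ⊗ C`. -/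
def tensorIdeal (C : Type*) [NonUnitalRing C] [Module F C] (I : Submodule F R) :
    Submodule F (R ⊗[F] C) :=
  Submodule.span F {t | ∃ r ∈ I, ∃ c : C, t = r ⊗ₜ[F] c}

theorem mul_mem_tensorIdeal {I : Submodule F R} (hI : ∀ x, ∀ y ∈ I, x * y ∈ I) (x : R ⊗[F] C)
    {y : R ⊗[F] C} (hy : y ∈ tensorIdeal C I) : x * y ∈ tensorIdeal C I := by
  refine LinearMap.BilinMap.apply_apply_mem_of_mem_span (tensorIdeal C I) _ _
    (LinearMap.mul F (R ⊗[F] C)) ?_ x y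
    ((TensorProduct.span_tmul_eq_top F R C).ge (Submodule.mem_top (x := x))) hy
  rintro _ ⟨r, c, rfl⟩ _ ⟨r', hr', c', rfl⟩
  rw [LinearMap.mul_apply_apply, Algebra.TensorProduct.tmul_mul_tmul]
  exact Submodule.subset_span ⟨_, hI _ _ hr', _, rfl⟩

theorem tensorIdeal_mul_mem {I : Submodule F R} (hI : ∀ x, ∀ y ∈ I, y * x ∈ I) (x : R ⊗[F] C)
    {y : R ⊗[F] C} (hy : y ∈ tensorIdeal C I) : y * x ∈ tensorIdeal C I := by
  refine LinearMap.BilinMap.apply_apply_mem_of_mem_span (tensorIdeal C I) _ _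
    (LinearMap.mul F (R ⊗[F] C)) ?_ y x hy
    ((TensorProduct.span_tmul_eq_top F R C).ge (Submodule.mem_top (x := x)))
  rintro _ ⟨r', hr', c', rfl⟩ _ ⟨r, c, rfl⟩
  rw [LinearMap.mul_apply_apply, Algebra.TensorProduct.tmul_mul_tmul]
  exact Submodule.subset_span ⟨_, hI _ _ hr', _, rfl⟩

theorem isTIdeal_gradedIdentitiesMod_tensorIdeal {ℛ : G × H → Submodule F R}
    {𝒞 : H → Submodule F C}
    (hℛ : ∀ {g h : G × H} {a b : R}, a ∈ ℛ g → b ∈ ℛ h → a * b ∈ ℛ (g * h))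
    (h𝒞 : ∀ {g h : H} {a b : C}, a ∈ 𝒞 g → b ∈ 𝒞 h → a * b ∈ 𝒞 (g * h)) {I : Submodule F R}
    (hl : ∀ x, ∀ y ∈ I, x * y ∈ I) (hr : ∀ x, ∀ y ∈ I, y * x ∈ I) :
    IsTIdeal (gradedIdentitiesMod (matchedGrading ℛ 𝒞) (tensorIdeal C I)) :=
  isTIdeal_gradedIdentitiesMod (matchedGrading_mul_mem hℛ h𝒞)
    (fun x _ hy => mul_mem_tensorIdeal hl x hy) fun x _ hy => tensorIdeal_mul_mem hr x hy

/-- A functional on `C` that does not vanish at `c` induces a map `R ⊗ C → R` taking `I ⊗ C` into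
`I` and `r ⊗ c` to a nonzero multiple of `r`. -/
theorem mem_of_tmul_mem_tensorIdeal {I : Submodule F R} {r : R} {c : C} (hc : c ≠ 0)
    (h : r ⊗ₜ[F] c ∈ tensorIdeal C I) : r ∈ I := by
  obtain ⟨φ, hφ⟩ : ∃ φ : Module.Dual F C, φ c ≠ 0 := by
    by_contra! hφ
    exact hc ((Module.forall_dual_apply_eq_zero_iff F c).1 hφ)
  let ψ : R ⊗[F] C →ₗ[F] R := (TensorProduct.rid F R).toLinearMap ∘ₗ φ.lTensor R
  have hψ : ∀ r c, ψ (r ⊗ₜ[F] c) = φ c • r := by intro r c; simp [ψ]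
  have hle : tensorIdeal C I ≤ I.comap ψ := by
    refine Submodule.span_le.2 ?_
    rintro _ ⟨r, hr, c, rfl⟩
    change ψ _ ∈ I
    rw [hψ]
    exact Submodule.smul_mem _ _ hr
  have := hle h
  rw [Submodule.mem_comap, hψ] at this
  exact (Submodule.smul_mem_iff _ hφ).1 this

theorem phi_mem_gradedIdentities {ℛ : G → Submodule F R} {𝒞 : H → Submodule F C}
    (h𝒞 : ∀ {g h : H} {a b : C}, a ∈ 𝒞 g → b ∈ 𝒞 h → a * b ∈ 𝒞 (g * h))
    (hc : IsColorCommutative β 𝒞) (h : ℕ → H) {n : ℕ} {g : Fin (n + 1) → G} {f : FreeAlg F G}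
    (hf : f ∈ multilinear F g) (hfR : f ∈ gradedIdentities ℛ) :
    phi β h f ∈ gradedIdentities (tensorGrading ℛ 𝒞) := by
  obtain ⟨c, rfl⟩ := mem_multilinear_iff.1 hf
  intro a ha
  rw [phi_sum_permWord, evalHom_sum_permWord, ← Submodule.mem_bot F]
  -- By multilinearity it suffices to evaluate at pure tensors, where the signs cancel.
  refine sum_nprod_mem_of_span (A := R ⊗[F] C) _
    (fun i => {t | ∃ r ∈ ℛ (g i), ∃ c ∈ 𝒞 (h i), t = r ⊗ₜ[F] c}) ⊥ ?_
    (fun i => a ((g i, h i), (i : ℕ))) fun i => ha ((g i, h i), (i : ℕ))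
  intro x hx
  choose r hr y hy hxry using hx
  obtain ⟨b, hb, hbr⟩ := exists_assignment g r hr
  have h0 := hfR b hb
  rw [evalHom_sum_permWord] at h0
  simp only [hbr] at h0
  have hterm : ∀ σ : Equiv.Perm (Fin (n + 1)),
      (c σ * (colorSign β (permWord (fun i : Fin (n + 1) => h i) σ) : F)) • nprod F n (x ∘ σ) =
        (c σ • nprod F n fun i => r (σ i)) ⊗ₜ[F] nprod F n y := by
    intro σ
    have hx' : x ∘ σ = fun i => r (σ i) ⊗ₜ[F] (y ∘ σ) i := funext fun i => hxry (σ i)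
    rw [hx', nprod_tmul, mul_smul, ← TensorProduct.tmul_smul,
      colorSign_smul_nprod h𝒞 hc (fun i : Fin (n + 1) => h i) hy, TensorProduct.smul_tmul']
  rw [Submodule.mem_bot, Finset.sum_congr rfl fun σ _ => hterm σ, ← TensorProduct.sum_tmul, h0,
    TensorProduct.zero_tmul]

end Tensor

/-- If the polynomials `ϕ_h(e)`, `e ∈ E`, lie in a `T`-ideal, then so do the polynomials `ϕ_h(f)`
for all multilinear consequences `f` of `E`. -/
theorem phi_mem_of_mem_tIdeal {J : Submodule F (FreeAlg F (G × H))} (hJ : IsTIdeal J)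
    {E : Set (FreeAlg F G)} (hE : ∀ f ∈ E, ∃ (n : ℕ) (g : Fin (n + 1) → G), f ∈ multilinear F g)
    (hEJ : ∀ f ∈ E, ∀ (n : ℕ) (h : Fin n → H), phi β (extendTuple h) f ∈ J) {n : ℕ}
    {g : Fin (n + 1) → G} (h : Fin (n + 1) → H) {f : FreeAlg F G} (hf : f ∈ multilinear F g)
    (hfE : f ∈ tIdeal E) : phi β (extendTuple h) f ∈ J := by
  obtain ⟨D, _, _, _, _, 𝒟, hD, hDc, y, hy, hy0⟩ := exists_color_model β.inv h
  let 𝒯 : G → Submodule F (FreeAlg F (G × H) ⊗[F] D) := matchedGrading (freeComponent F) 𝒟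
  -- The right-hand side is a `T`-ideal, so only the generators `e ∈ E` have to be checked.
  have hle : tIdeal E ≤ gradedIdentitiesMod 𝒯 (tensorIdeal D J) := by
    have hfree : ∀ {p q : G × H} {a b : FreeAlg F (G × H)}, a ∈ freeComponent F p →
        b ∈ freeComponent F q → a * b ∈ freeComponent F (p * q) :=
      fun ha hb => freeComponent_mul_mem ha hb
    refine tIdeal_le (isTIdeal_gradedIdentitiesMod_tensorIdeal
      (ℛ := freeComponent F) (𝒞 := 𝒟) (I := J) hfree hD.mul_mem
      (fun u _ hv => hJ.mul_mem_left u hv) fun u _ hv => hJ.mul_mem_right u hv) ?_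
    intro e he a ha
    obtain ⟨m, k, hek⟩ := hE e he
    obtain ⟨c, rfl⟩ := mem_multilinear_iff.1 hek
    rw [evalHom_sum_permWord]
    refine sum_nprod_mem_of_span (A := FreeAlg F (G × H) ⊗[F] D) c
      (fun i => {t | ∃ h, ∃ r ∈ freeComponent F (k i, h), ∃ c ∈ 𝒟 h, t = r ⊗ₜ[F] c}) _ ?_
      (fun i => a (k i, (i : ℕ))) fun i => ha (k i, (i : ℕ))
    intro x hx
    -- The `H`-degrees `l i` may vary from one tensor to the next; this is why all tuples are needed
    -- in the generating set.
    choose l r hr z hz hxrz using hx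
    obtain ⟨b, hb, hbr⟩ := exists_assignment (𝒜 := freeComponent F) (fun i => (k i, l i)) r hr
    have hmem := evalHom_mem_of_isTIdeal hJ (hEJ _ he _ l) hb
    rw [phi_extendTuple_sum_permWord, evalHom_sum_permWord] at hmem
    simp only [hbr] at hmem
    -- Reordering the `D`-factors creates exactly the sign that `phi` inserts, because `D` belongs
    -- to the inverse bicharacter.
    have hterm : ∀ σ : Equiv.Perm (Fin (m + 1)), c σ • nprod F m (x ∘ σ) =
        ((c σ * (colorSign β (permWord l σ) : F)) • nprod F m fun i => r (σ i)) ⊗ₜ[F]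
          nprod F m z := by
      intro σ
      have hx' : x ∘ σ = fun i => r (σ i) ⊗ₜ[F] (z ∘ σ) i := funext fun i => hxrz (σ i)
      rw [hx', nprod_tmul, nprod_comp_eq_colorSign_smul hDc l hz, mul_smul, TensorProduct.tmul_smul,
        TensorProduct.smul_tmul', TensorProduct.smul_tmul']
    rw [Finset.sum_congr rfl fun σ _ => hterm σ, ← TensorProduct.sum_tmul]
    exact Submodule.subset_span ⟨_, hmem, _, rfl⟩
  obtain ⟨c, rfl⟩ := mem_multilinear_iff.1 hf
  -- At the variables themselves, the first tensor factor of the value is `phi β (extendTuple h) f`.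
  obtain ⟨a, ha, hav⟩ := exists_assignment (𝒜 := 𝒯) g
    (fun i => var F (g i, h i) i ⊗ₜ[F] y i) fun i =>
      Submodule.subset_span ⟨h i, _, var_mem_freeComponent _ _, _, hy i, rfl⟩
  have hmem := hle hfE a ha
  rw [evalHom_sum_permWord] at hmem
  simp only [hav] at hmem
  have hterm : ∀ σ : Equiv.Perm (Fin (n + 1)),
      (c σ • nprod F n fun i => var F (g (σ i), h (σ i)) (σ i) ⊗ₜ[F] y (σ i)) =
        ((c σ * (colorSign β (permWord h σ) : F)) • mono F (permWord (fun i => (g i, h i)) σ)) ⊗ₜ[F]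
          nprod F n y := by
    intro σ
    have hv := evalHom_permWord (F := F) (fun p : (G × H) × ℕ => var F p.1 p.2)
      (fun i => (g i, h i)) σ
    rw [evalHom_var_eq] at hv
    rw [nprod_tmul, ← hv, show (fun i => y (σ i)) = y ∘ σ from rfl,
      nprod_comp_eq_colorSign_smul hDc h hy, mul_smul, TensorProduct.tmul_smul,
      TensorProduct.smul_tmul', TensorProduct.smul_tmul']
  rw [Finset.sum_congr rfl fun σ _ => hterm σ, ← TensorProduct.sum_tmul] at hmem
  rw [phi_extendTuple_sum_permWord]
  exact mem_of_tmul_mem_tensorIdeal hy0 hmem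

/-- A generator of the variety of color commutative algebras has nonzero multilinear monomials. -/
theorem GeneratesColorVariety.exists_nprod_ne_zero {C : Type*} [NonUnitalRing C] [Module F C]
    [IsScalarTower F C C] [SMulCommClass F C C] {𝒞 : H → Submodule F C}
    (hC : GeneratesColorVariety β 𝒞) {n : ℕ} (h : Fin (n + 1) → H) :
    ∃ y : Fin (n + 1) → C, (∀ i, y i ∈ 𝒞 (h i)) ∧ nprod F n y ≠ 0 := by
  by_contra! hcon
  obtain ⟨A, _, _, _, _, 𝒜, hA, hAc, x, hx, hx0⟩ := exists_color_model β h
  -- If all such products vanished, a single monomial would be an identity of `C`, hence of the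
  -- model.
  have hid : mono F (permWord h 1) ∈ gradedIdentities 𝒞 := by
    intro a ha
    rw [evalHom_permWord]
    exact hcon (fun i => a (h i, (i : ℕ))) fun i => ha (h i, (i : ℕ))
  obtain ⟨a, ha, hax⟩ := exists_assignment h x hx
  have h0 := hC.identities_subset A 𝒜 hA hAc hid a ha
  rw [evalHom_permWord] at h0
  simp only [Equiv.Perm.one_apply, hax] at h0
  exact hx0 h0

theorem isMultilinearGeneratingSet_phi [CharZero F] {C : Type*} [NonUnitalRing C] [Module F C]
    [IsScalarTower F C C] [SMulCommClass F C C]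
    {𝒞 : H → Submodule F C} (hC : GeneratesColorVariety β 𝒞)
    {R : Type*} [NonUnitalRing R] [Module F R] [IsScalarTower F R R] [SMulCommClass F R R]
    {ℛ : G → Submodule F R} (hR : IsGrading ℛ) {E : Set (FreeAlg F G)}
    (hE : IsMultilinearGeneratingSet E (gradedIdentities ℛ)) :
    IsMultilinearGeneratingSet
      {s : FreeAlg F (G × H) | ∃ f ∈ E, ∃ (n : ℕ) (h : Fin n → H), s = phi β (extendTuple h) f}
      (gradedIdentities (tensorGrading ℛ 𝒞)) := by
  obtain ⟨hEm, hET⟩ := hE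
  have hCm : ∀ {g h : H} {a b : C}, a ∈ 𝒞 g → b ∈ 𝒞 h → a * b ∈ 𝒞 (g * h) :=
    fun ha hb => hC.isGrading.mul_mem ha hb
  refine ⟨?_, Set.Subset.antisymm ?_ ?_⟩
  · rintro _ ⟨f, hf, n, h, rfl⟩
    obtain ⟨m, g, hg⟩ := hEm f hf
    exact ⟨m, _, phi_mem_multilinear _ hg⟩
  · rw [← coe_gradedIdentitiesMod_bot]
    refine tIdeal_le (isTIdeal_gradedIdentitiesMod
      (tensorGrading_mul_mem hR.mul_mem hCm) (by simp) (by simp)) ?_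
    rw [coe_gradedIdentitiesMod_bot]
    rintro _ ⟨f, hf, n, h, rfl⟩
    obtain ⟨m, g, hg⟩ := hEm f hf
    exact phi_mem_gradedIdentities hCm hC.isColorCommutative _ hg
      (hET ▸ subset_tIdeal E hf)
  · refine gradedIdentities_subset_of_multilinear (isTIdeal_tIdeal _) ?_
    intro n k f hf hfT
    obtain ⟨c, rfl⟩ := mem_multilinear_iff.1 hf
    let g : Fin (n + 1) → G := fun i => (k i).1
    let h : Fin (n + 1) → H := fun i => (k i).2
    -- Dividing by the signs makes the given polynomial the image of `q` under `phi`.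
    let d : Equiv.Perm (Fin (n + 1)) → F := fun σ =>
      c σ * ((colorSign β (permWord h σ) : F))⁻¹
    let q : FreeAlg F G := ∑ σ, d σ • mono F (permWord g σ)
    have hq : q ∈ multilinear F g := mem_multilinear_iff.2 ⟨d, rfl⟩
    have hphi : phi β (extendTuple h) q =
        ∑ σ, c σ • mono F (permWord k σ) := by
      rw [phi_extendTuple_sum_permWord]
      refine Finset.sum_congr rfl fun σ _ => ?_
      rw [inv_mul_cancel_right₀ (Units.ne_zero _)]
    have hqR : q ∈ gradedIdentities ℛ := by
      intro a ha
      obtain ⟨y, hy, hy0⟩ := hC.exists_nprod_ne_zero h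
      obtain ⟨b, hb, hbx⟩ := exists_assignment (𝒜 := tensorGrading ℛ 𝒞) k
        (fun i => a (g i, (i : ℕ)) ⊗ₜ[F] y i) fun i =>
          Submodule.subset_span ⟨_, ha (g i, (i : ℕ)), _, hy i, rfl⟩
      have h0 := hfT b hb
      rw [evalHom_sum_permWord] at h0
      simp only [hbx] at h0
      have hterm : ∀ σ : Equiv.Perm (Fin (n + 1)),
          (c σ • nprod F n fun i => a (g (σ i), (σ i : ℕ)) ⊗ₜ[F] y (σ i)) =
            (d σ • nprod F n fun i => a (g (σ i), (σ i : ℕ))) ⊗ₜ[F]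
              nprod F n y := by
        intro σ
        rw [nprod_tmul,
          ← colorSign_smul_nprod hCm hC.isColorCommutative h hy σ,
          TensorProduct.tmul_smul, ← TensorProduct.smul_tmul', smul_smul,
          mul_comm, inv_mul_cancel_right₀ (Units.ne_zero _)]
        rfl
      rw [Finset.sum_congr rfl fun σ _ => hterm σ, ← TensorProduct.sum_tmul] at h0
      rw [evalHom_sum_permWord]
      -- With `I = ⊥`: a zero tensor whose second factor is nonzero has zero first factor.
      exact (Submodule.mem_bot F).1 (mem_of_tmul_mem_tensorIdeal hy0
        (h0 ▸ zero_mem (tensorIdeal C (⊥ : Submodule F R))))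
    rw [← hphi]
    refine phi_mem_of_mem_tIdeal (isTIdeal_tIdeal _) hEm ?_ h hq
      (by rw [← SetLike.mem_coe, hET]; exact hqR)
    exact fun f hf n h => subset_tIdeal _ ⟨f, hf, n, h, rfl⟩

end Main

end

end ColorPI

theorem mainTheorem5 {F : Type*} [Field F] [CharZero F] {G : Type*} [Group G]
    {H : Type*} [CommGroup H] (β : ColorPI.SkewBicharacter F H)
    {C : Type*} [NonUnitalRing C] [Module F C] [IsScalarTower F C C] [SMulCommClass F C C]
    (𝒞 : H → Submodule F C) (hC : ColorPI.GeneratesColorVariety β 𝒞)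
    {R : Type*} [NonUnitalRing R] [Module F R] [IsScalarTower F R R] [SMulCommClass F R R]
    (ℛ : G → Submodule F R) (hR : ColorPI.IsGrading ℛ)
    (E : Set (ColorPI.FreeAlg F G))
    (hE : ColorPI.IsMultilinearGeneratingSet E (ColorPI.gradedIdentities ℛ)) :
    ColorPI.IsMultilinearGeneratingSet
      {s : ColorPI.FreeAlg F (G × H) | ∃ f ∈ E, ∃ (n : ℕ) (h : Fin n → H),
        s = ColorPI.phi β (ColorPI.extendTuple h) f}
      (ColorPI.gradedIdentities (ColorPI.tensorGrading ℛ 𝒞)) :=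
  ColorPI.isMultilinearGeneratingSet_phi hC hR hE
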